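/- **Setting.** Let $N$ be a point process on $\mathbb R$ with finitely or infinitely many points, listed in a sequence: a random element of $\bigsqcup_{n\in\mathbb N\cup\{\infty\}}\mathbb R^n$. Let $(\mathcal T,(V(u))_{u\in\mathcal T})$ be the branching random walk with reproduction law $N$: the root $\varnothing$ has $V(\varnothing)=0$, and every vertex $u$ has, independently of the other vertices of its generation and of the past, children whose positions are the points of a copy of $N$ translated by $V(u)$. Write $\mathbf P,\mathbf E$ for its law and expectation, $|u|$ for the generation of $u$, and $\psi(t)=\mathbf E\big[\sum_{|u|=1}e^{-tV(u)}\big]\in[0,\infty]$ for $t\ge 0$. Put $\kappa=\inf\{t>1:\psi(t)\ge 1\}$ (with $\inf\emptyset=\infty$) and suppose that $\kappa\in(1,2]$ and that * $\psi(0)>1$, $\min_{t\in[0,1]}\psi(t)=1$, and $\mathbf E\big[\sum_{|u|=1}V(u)e^{-V(u)}\big]>0$ (that is, $\psi'(1)<0$; the negative part has finite expectation and the positive part may have infinite expectation); * $\psi(\kappa)=1$, $\ \mathbf E\big[\sum_{|u|=1}\max(-V(u),0)\,e^{-\kappa V(u)}\big]<\infty$ and $\mathbf E\big[\big(\sum_{|u|=1}e^{-V(u)}\big)^{\kappa}\big]<\infty$.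 For $n\ge 1$ let $\mathbf P_n$ (with expectation $\mathbf E_n$) be the joint law of the branching random walk and of the types $(\beta(u))_{u\in\mathcal T}$, $\beta(u)\in\{0,1,2,\dots\}$, where $\beta(\varnothing)=n$ and where, conditionally on $(\mathcal T,V)$, the types form a multitype Galton–Watson tree: given $\beta(u)=i$, the types of the children $u1,u2,\dots$ of $u$ are independent of the progenies of the other vertices and are negative multinomial. That is, for $i\ge 1$ and every finitely supported sequence $k_1,k_2,\dots$ of nonnegative integers, $$P^V\big(\beta(u1)=k_1,\beta(u2)=k_2,\dots\mid\beta(u)=i\big)=\frac{(i-1+\sum_j k_j)!}{(i-1)!\,\prod_j k_j!}\;\frac{\prod_j e^{-k_j(V(uj)-V(u))}}{\big(1+\sum_j e^{-(V(uj)-V(u))}\big)^{i+\sum_j k_j}},$$ while the children of a vertex of type $0$ all have type $0$. The set $\mathbb T=\{u:\beta(u)\ge 1\}$ is the range tree whose root has initial local time $n$: $\beta$ has the law of the edge local times, after $n$ excursions from an added parent of the root, of the nearest-neighbour walk on $\mathcal T$ that jumps from $u$ to a child $uj$ with probability proportional to $e^{-V(uj)}$ and to the parent of $u$ with probability proportional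 to $e^{-V(u)}$. Let $L^1$ be the number of vertices $v\neq\varnothing$ such that $\beta(v)=1$ and no vertex $w$ strictly between $\varnothing$ and $v$ has $\beta(w)=1$. Let $W_k=\sum_{|u|=k}e^{-V(u)}$, $k\ge 1$. **Proposition.** The martingale $(W_k)$ converges $\mathbf P$-almost surely to a finite limit $W_\infty$, and for every $\alpha\in(0,\kappa-1)$, $$\mathbf E_n\Big[\Big|\frac{L^1}{n}-W_\infty\Big|^{1+\alpha}\Big]\longrightarrow 0\qquad(n\to\infty).$$ -/

import Mathlib

open MeasureTheory ProbabilityTheory Filter Topology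
open scoped ENNReal

/-! ### Branching random walk -/

namespace RangeTree

/-- The state space `⨆ₙ ℝⁿ`, `n ∈ ℕ ∪ {∞}`, of the reproduction point process: a number of children
`p.1 ∈ ℕ ∪ {∞}` and the displacement of each child `i < p.1`. -/
abbrev Progeny : Type := Σ n : ℕ∞, ({i : ℕ // (i : ℕ∞) < n} → ℝ)

/-- The sum `∑ f(x)` over the points `x` of a point configuration. -/
noncomputable def Progeny.sum (p : Progeny) (f : ℝ → ℝ≥0∞) : ℝ≥0∞ := ∑' i, f (p.2 i)

/-- The weight `e^{-x}` of the `i`-th point `x` of a point configuration, and `0` if there is no such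
point. -/
noncomputable def Progeny.weight (p : Progeny) (i : ℕ) : ℝ≥0∞ :=
  if h : (i : ℕ∞) < p.1 then ENNReal.ofReal (Real.exp (-p.2 ⟨i, h⟩)) else 0

/-- Vertices are words over `ℕ`, read backwards: `[]` is the root and `i :: u` is the `i`-th child
of `u` (children are numbered from `0`). Hence the ancestors of a vertex are its suffixes. -/
abbrev Vertex : Type := List ℕ

/-- `StrictAncestor u v`: the vertex `u` is a strict ancestor of the vertex `v`. -/
def StrictAncestor (u v : Vertex) : Prop := u <:+ v ∧ u ≠ v

/-- An environment: the displacements of the children are attached to every word. Only those attached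
to the words that belong to the tree matter. -/
abbrev Env : Type := Vertex → Progeny

/-- `InTree ω u`: the word `u` is a vertex of the tree. -/
def InTree (ω : Env) : Vertex → Prop
  | [] => True
  | i :: u => InTree ω u ∧ (i : ℕ∞) < (ω u).1

open Classical in
/-- The position `V(u)` of a vertex `u` of the tree (with a dummy displacement `0` for words that
are not in the tree). -/
noncomputable def position (ω : Env) : Vertex → ℝ
  | [] => 0
  | i :: u => position ω u + if h : (i : ℕ∞) < (ω u).1 then (ω u).2 ⟨i, h⟩ else 0

/-- The law of the branching random walk with reproduction law `N`: the vertices have independent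
progenies with law `N`. -/
noncomputable def brwLaw (N : Measure Progeny) [IsProbabilityMeasure N] : Measure Env :=
  Measure.infinitePi fun _ : Vertex => N

/-- The Laplace transform `ψ(t) = E[∑_{|u|=1} e^{-t V(u)}]`. -/
noncomputable def psi (N : Measure Progeny) (t : ℝ) : ℝ≥0∞ :=
  ∫⁻ p, p.sum (fun x => ENNReal.ofReal (Real.exp (-(t * x)))) ∂N

/-- `κ = inf {t > 1 : ψ(t) ≥ 1}`, with `inf ∅ = ∞`. -/
noncomputable def kappa (N : Measure Progeny) : EReal :=
  sInf ((fun t : ℝ => (t : EReal)) '' {t : ℝ | 1 < t ∧ 1 ≤ psi N t})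

/-- The hypothesis of criticality: `ψ(0) > 1`, `min_{[0,1]} ψ = 1` and
`ψ'(1) = -E[∑_{|u|=1} V(u) e^{-V(u)}] < 0`. The last condition says that the expectation of the
negative part is strictly less than that of the positive part; in particular the former is
finite. -/
structure HypC (N : Measure Progeny) : Prop where
  mean_gt_one : 1 < psi N 0
  min_eq_one : IsLeast (psi N '' Set.Icc 0 1) 1
  deriv_neg : ∫⁻ p, p.sum (fun x => ENNReal.ofReal (-x * Real.exp (-x))) ∂N <
    ∫⁻ p, p.sum (fun x => ENNReal.ofReal (x * Real.exp (-x))) ∂N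

/-- The integrability hypotheses at the exponent `κ`: `ψ(κ) = 1`,
`E[∑_{|u|=1} max(-V(u), 0) e^{-κ V(u)}] < ∞` and `E[(∑_{|u|=1} e^{-V(u)})^κ] < ∞`. -/
structure HypKappa (N : Measure Progeny) (κ : ℝ) : Prop where
  psi_eq_one : psi N κ = 1
  log_moment :
    ∫⁻ p, p.sum (fun x => ENNReal.ofReal (max (-x) 0 * Real.exp (-(κ * x)))) ∂N < ⊤
  moment : ∫⁻ p, (p.sum fun x => ENNReal.ofReal (Real.exp (-x))) ^ κ ∂N < ⊤

/-- The additive martingale `W_k = ∑_{|u|=k} e^{-V(u)}`. -/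
noncomputable def W (k : ℕ) (ω : Env) : ℝ≥0∞ :=
  ∑' u : {u : Vertex // u.length = k ∧ InTree ω u}, ENNReal.ofReal (Real.exp (-position ω u))

/-- `W_∞ = lim W_k` (an upper limit, so that it is defined everywhere). -/
noncomputable def Winf (ω : Env) : ℝ≥0∞ := limsup (fun k => W k ω) atTop

/-! ### Negative multinomial laws -/

/-- The negative multinomial weight, for `i + 1` trials, of the finitely supported sequence `k`:
`binom(|k| + i; k₀, k₁, …, i) ∏ aⱼ^{kⱼ} / (1 + ∑ aⱼ)^{|k| + i + 1}`, where `|k| = ∑ kⱼ`; here the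
multinomial coefficient `binom(|k| + i; k₀, k₁, …, i)` is `binom(|k| + i, i) binom(|k|; k₀, k₁, …)`. -/
noncomputable def negMultinomialWeight (a : ℕ → ℝ≥0∞) (i : ℕ) (k : ℕ →₀ ℕ) : ℝ≥0∞ :=
  (((k.degree + i).choose i * k.multinomial : ℕ) : ℝ≥0∞) * (k.prod fun j m => a j ^ m) /
    (1 + ∑' j, a j) ^ (k.degree + i + 1)

lemma tsum_multinomial (a : ℕ → ℝ≥0∞) (m : ℕ) :
    ∑' k : {k : ℕ →₀ ℕ // k.degree = m},
      ((k.1.multinomial : ℕ) : ℝ≥0∞) * (k.1.prod fun j r => a j ^ r) = (∑' j, a j) ^ m := by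
  classical
  set g : (ℕ →₀ ℕ) → ℝ≥0∞ := fun k => ((k.multinomial : ℕ) : ℝ≥0∞) * (k.prod fun j r => a j ^ r)
    with hg
  have key : ∀ s : Finset ℕ, ∑ k ∈ s.finsuppAntidiag m, g k = (∑ j ∈ s, a j) ^ m := by
    intro s
    rw [Finset.sum_pow_eq_sum_piAntidiag]
    refine Finset.sum_bij' (fun k _ => (k : ℕ → ℕ))
      (fun f hf => Finsupp.onFinset s f fun i hi => (Finset.mem_piAntidiag.1 hf).2 i hi)
      ?_ ?_ ?_ ?_ ?_
    · intro k hk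
      rw [Finset.mem_finsuppAntidiag] at hk
      rw [Finset.mem_piAntidiag]
      exact ⟨hk.1, fun i hi => hk.2 (Finsupp.mem_support_iff.2 hi)⟩
    · intro f hf
      rw [Finset.mem_finsuppAntidiag]
      refine ⟨(Finset.mem_piAntidiag.1 hf).1, ?_⟩
      intro i hi
      exact (Finset.mem_piAntidiag.1 hf).2 i (by simpa using hi)
    · intro k hk
      ext i
      simp
    · intro f hf
      rfl
    · intro k hk
      rw [Finset.mem_finsuppAntidiag] at hk
      simp only [hg]
      rw [Finsupp.multinomial_eq_of_support_subset hk.2,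
        Finsupp.prod_of_support_subset _ hk.2 _ (by simp)]
  have mem : ∀ (s : Finset ℕ) (k : ℕ →₀ ℕ), k ∈ s.finsuppAntidiag m ↔
      k.degree = m ∧ k.support ⊆ s := by
    intro s k
    rw [Finset.mem_finsuppAntidiag]
    refine and_congr_left fun h => ?_
    rw [Finsupp.degree_apply, Finset.sum_subset h]
    intro i _ hi
    simpa using hi
  change ∑' k : {k : ℕ →₀ ℕ // k.degree = m}, g k = _
  apply le_antisymm
  · rw [ENNReal.tsum_eq_iSup_sum]
    refine iSup_le fun t => ?_
    have h1 : ∑ k ∈ t, g k ≤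
        ∑ k ∈ (t.biUnion fun k => k.1.support).finsuppAntidiag m, g k := by
      have h0 := Finset.sum_map t (Function.Embedding.subtype fun k : ℕ →₀ ℕ => k.degree = m) g
      simp only [Function.Embedding.coe_subtype] at h0
      rw [← h0]
      refine Finset.sum_le_sum_of_subset fun k hk => ?_
      obtain ⟨k', hk', rfl⟩ := Finset.mem_map.1 hk
      rw [mem]
      exact ⟨k'.2, Finset.subset_biUnion_of_mem (fun k : {k : ℕ →₀ ℕ // k.degree = m} =>
        k.1.support) hk'⟩
    rw [key] at h1
    exact h1.trans (pow_le_pow_left₀ zero_le (ENNReal.sum_le_tsum _) m)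
  · have h2 : Tendsto (fun s : Finset ℕ => (∑ j ∈ s, a j) ^ m) atTop (𝓝 ((∑' j, a j) ^ m)) :=
      ((ENNReal.continuous_pow m).tendsto _).comp ENNReal.summable.hasSum
    refine le_of_tendsto' h2 fun s => ?_
    rw [← key, ← Finset.sum_subtype_of_mem g (p := fun k => k.degree = m)
      fun k hk => ((mem s k).1 hk).1]
    exact ENNReal.sum_le_tsum _

lemma tsum_negMultinomialWeight (a : ℕ → ℝ≥0∞) (ha : ∑' j, a j ≠ ⊤) (i : ℕ) :
    ∑' k, negMultinomialWeight a i k = 1 := by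
  set S := ∑' j, a j with hS
  have h1 : ∑' k, negMultinomialWeight a i k =
      ∑' m : ℕ, ((m + i).choose i : ℝ≥0∞) * S ^ m / (1 + S) ^ (m + i + 1) := by
    rw [← ENNReal.tsum_fiberwise _ (fun k : ℕ →₀ ℕ => k.degree)]
    refine tsum_congr fun m => ?_
    rw [hS, ← tsum_multinomial a m, ← ENNReal.tsum_mul_left, div_eq_mul_inv,
      ← ENNReal.tsum_mul_right]
    refine tsum_congr fun k => ?_
    have hk : k.1.degree = m := k.2
    simp only [negMultinomialWeight, hk, Nat.cast_mul, div_eq_mul_inv]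
    rw [mul_assoc ((m + i).choose i : ℝ≥0∞)]
  rw [h1]
  clear_value S
  lift S to NNReal using ha
  set r : ℝ := S / (1 + S) with hr
  have hpos : (0 : ℝ) < 1 + S := by positivity
  have hr0 : 0 ≤ r := by positivity
  have hr1 : r < 1 := by rw [hr, div_lt_one hpos]; linarith
  have hsum := (hasSum_choose_mul_geometric_of_norm_lt_one (𝕜 := ℝ) i (r := r)
    (by rwa [Real.norm_of_nonneg hr0])).mul_right (1 / (1 + (S : ℝ)) ^ (i + 1))
  have h1r : 1 - r = 1 / (1 + S) := by rw [hr]; field_simp; ring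
  have hval : 1 / (1 - r) ^ (i + 1) * (1 / (1 + (S : ℝ)) ^ (i + 1)) = 1 := by
    rw [h1r, div_pow, one_pow]; field_simp
  rw [hval] at hsum
  have hterm : ∀ m : ℕ, ((m + i).choose i : ℝ≥0∞) * (S : ℝ≥0∞) ^ m / (1 + (S : ℝ≥0∞)) ^ (m + i + 1)
      = ENNReal.ofReal (((m + i).choose i : ℝ) * r ^ m * (1 / (1 + (S : ℝ)) ^ (i + 1))) := by
    intro m
    have : ((m + i).choose i : ℝ) * r ^ m * (1 / (1 + (S : ℝ)) ^ (i + 1)) =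
        ((((m + i).choose i : NNReal) * S ^ m / (1 + S) ^ (m + i + 1) : NNReal) : ℝ) := by
      rw [hr, div_pow]; push_cast; field_simp; ring
    rw [this, ENNReal.ofReal_coe_nnreal, ENNReal.coe_div (by positivity)]
    push_cast
    rfl
  rw [tsum_congr hterm, ← ENNReal.ofReal_tsum_of_nonneg (fun m => by positivity) hsum.summable,
    hsum.tsum_eq, ENNReal.ofReal_one]

open Classical in
/-- The negative multinomial law with a given number of trials and weights `aⱼ`, that is with event
probabilities `aⱼ / (1 + ∑ aₗ)`. With `0` trials it is the Dirac mass at `0`. (If `∑ aⱼ = ∞`, which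
has probability zero below, the value is a dummy.) -/
noncomputable def negMultinomial (a : ℕ → ℝ≥0∞) : ℕ → PMF (ℕ →₀ ℕ)
  | 0 => PMF.pure 0
  | i + 1 =>
    if ha : ∑' j, a j ≠ ⊤ then
      ⟨negMultinomialWeight a i, tsum_negMultinomialWeight a ha i ▸ ENNReal.summable.hasSum⟩
    else PMF.pure 0

/-! ### The range tree -/

/-- The quenched offspring law `ζ` of a vertex of type (edge local time) `i` whose children have
the displacements `p`: the types of the children are negative multinomial with `i` trials and
weights `e^{-p_j}`. These event probabilities `e^{-p_j} / (1 + ∑ e^{-p_l})` are the jump probabilities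
of the walk in the environment from the vertex to its children, the trials being its `i` visits from
the parent, each of which ends with a jump back to the parent.
Children of type `0` are those that do not belong to the range. -/
noncomputable def offspringLaw (p : Progeny) (i : ℕ) : Measure (ℕ → ℕ) :=
  ((negMultinomial p.weight i).map fun k j => k j).toMeasure

instance (p : Progeny) (i : ℕ) : IsProbabilityMeasure (offspringLaw p i) := by
  unfold offspringLaw; infer_instance

/-- The types of all vertices of the multitype tree with root of type `n`, when a vertex `u` which has
type `i` has the progeny `ξ (u, i)`. -/
def edgeLocalTime (n : ℕ) (ξ : Vertex × ℕ → ℕ → ℕ) : Vertex → ℕ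
  | [] => n
  | j :: u => ξ (u, edgeLocalTime n ξ u) j

lemma measurable_edgeLocalTime (n : ℕ) : Measurable (edgeLocalTime n) := by
  refine measurable_pi_lambda _ fun u => ?_
  induction u with
  | nil => exact measurable_const
  | cons j u ih =>
    have h : Measurable fun x : (Vertex × ℕ → ℕ → ℕ) × ℕ => x.1 (u, x.2) j :=
      measurable_from_prod_countable_left fun y =>
        (measurable_pi_apply j).comp (measurable_pi_apply ((u, y) : Vertex × ℕ))
    exact h.comp (measurable_id.prodMk ih)

/-- The quenched law, in the environment `ω`, of the range tree with its edge local times `β`, when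
the root has type `n`: a multitype Galton-Watson tree, in which a vertex `u` of type `i` has offspring
law `offspringLaw (ω u) i`, independently of the other vertices. The tree is `{u | β u ≠ 0}`. -/
noncomputable def quenchedLaw (n : ℕ) (ω : Env) : Measure (Vertex → ℕ) :=
  (Measure.infinitePi fun x : Vertex × ℕ => offspringLaw (ω x.1) x.2).map (edgeLocalTime n)

/-- The annealed expectation `E_n`: the quenched expectation averaged over the environment. -/
noncomputable def annealedExp (N : Measure Progeny) [IsProbabilityMeasure N] (n : ℕ)
    (F : Env → (Vertex → ℕ) → ℝ≥0∞) : ℝ≥0∞ :=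
  ∫⁻ ω, ∫⁻ β, F ω β ∂quenchedLaw n ω ∂brwLaw N

/-- The line `ℒ¹_u`: strict descendants of `u` of type `1` without any vertex of type `1` strictly
between `u` and them. -/
def lineOne (β : Vertex → ℕ) (u : Vertex) : Set Vertex :=
  {v | StrictAncestor u v ∧ β v = 1 ∧ ∀ w, StrictAncestor u w → StrictAncestor w v → β w ≠ 1}

/-- `L¹`, the number of elements of the line `ℒ¹` of the root. -/
noncomputable def L1 (β : Vertex → ℕ) : ℝ≥0∞ := ((lineOne β []).encard : ℝ≥0∞)

/-- `|x - y|` for `x, y ∈ [0, ∞]`. -/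
noncomputable def absDiff (x y : ℝ≥0∞) : ℝ≥0∞ := (x - y) + (y - x)

end RangeTree

/-!
The martingale of types `M_m` counts the vertices at which the type `1` is reached for the first time,
up to generation `m`, and adds the types of those vertices of generation `m` before which the type `1`
has not been reached; it increases to `L¹` up to a negligible error. For the root type `n` it is
compared with the additive martingale `n W_m`. The contribution of one vertex `u` to the difference
`D_m = M_m - n W_m` is the innovation `(Z_u - x_u) - w_u (S_u - 1)`, where `x_u` is the type, killed at
the first `1`, `w_u = n e^{-V(u)}` is the weight, `Z_u` is the sum of the types of the children and
`S_u = ∑ e^{-(V(uj) - V(u))}`.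

All the randomness can be attached to the vertices in an independent way (`map_compProd_eq_treeLaw`).
Then an innovation is centred given the randomness of all vertices that are not longer, and, since
`|a + b|^p ≤ |a|^p + (linear term) b + 2 p |b|^p` for `1 < p ≤ 2`, the `p`-th moment of a sum of
innovations is at most `2 p` times the sum of their `p`-th moments
(`lintegral_abs_sum_innovation_rpow_le`). As `Z_u - x_u = (Z_u - x_u S_u) + x_u (S_u - 1)`, the `p`-th
moment of an innovation is of order `x_u + |x_u - w_u|^p` (`innovationMoment_le`); the linear
term comes from interpolating between the first two moments of the negative multinomial law, computed
by size biasing. It remains to sum over the tree, with `p = 1 + α` and `q = 1 + α / 2`.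

* Since `ψ(p) < 1`, the expected sum of `|x_u - w_u|^p` contracts from one generation to the next, up
  to a multiple of the expected sum of `x_u` (`exists_lintegral_discrepancy_child_le`), and it vanishes
  at the root.
* Since `ψ(q) < 1`, and small types have children of type `1` with a probability bounded below, the
  function `i ↦ i^q + D i` is a Lyapunov function for the killed types (`exists_lyapunov`), so that the
  expected sum of `x_u` over the whole tree is at most `n^q + D n`.

Hence `E |D_m|^p = O(n^q)` uniformly in `m`, which is `o(n^p)`, and Fatou's lemma gives the claim for
`L¹`. The almost sure convergence of `W_m` comes from the same moment inequality with root type `0`: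
`E |W_{m+1} - W_m|^p` decreases geometrically, so that the increments are almost surely summable.
-/

/-! ### The probability space -/

lemma measurable_infinitePi_kernel {A ι : Type*} [MeasurableSpace A] {X : ι → Type*}
    [∀ i, MeasurableSpace (X i)] (μ : A → (i : ι) → Measure (X i))
    [∀ a i, IsProbabilityMeasure (μ a i)] (h : ∀ i, Measurable fun a => μ a i) :
    Measurable fun a => Measure.infinitePi (μ a) := by
  classical
  refine Measurable.measure_of_isPiSystem_of_isProbabilityMeasure
    (generateFrom_squareCylinders (α := X)).symm
    (isPiSystem_squareCylinders (fun i => MeasurableSpace.isPiSystem_measurableSet) (by simp)) ?_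
  rintro _ ⟨s, t, ht, rfl⟩
  simp only [Set.mem_pi, Set.mem_univ, forall_true_left, Set.mem_ofPred_eq] at ht
  have : ∀ a, Measure.infinitePi (μ a) (Set.pi s t) = ∏ i ∈ s, μ a i (t i) := fun a =>
    Measure.infinitePi_pi _ fun i _ => ht i
  simp only [this]
  exact Finset.measurable_prod _ fun i _ => (Measure.measurable_coe (ht i)).comp (h i)

/-- Resampling one coordinate does not change an infinite product measure. -/
lemma lintegral_infinitePi_update {ι X : Type*} [DecidableEq ι] [MeasurableSpace X]
    (μ : Measure X) [IsProbabilityMeasure μ] (u : ι) {F : (ι → X) → ℝ≥0∞} (hF : Measurable F) :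
    ∫⁻ η, F η ∂(Measure.infinitePi fun _ : ι => μ) =
      ∫⁻ η, ∫⁻ x, F (Function.update η u x) ∂μ ∂(Measure.infinitePi fun _ : ι => μ) := by
  have hm : Measurable fun z : (ι → X) × X => Function.update z.1 u z.2 := by
    refine measurable_pi_lambda _ fun v => ?_
    by_cases hv : v = u
    · subst hv; simpa using measurable_snd
    · simp only [Function.update_of_ne hv]; fun_prop
  have key : ((Measure.infinitePi fun _ : ι => μ).prod μ).map
      (fun z : (ι → X) × X => Function.update z.1 u z.2) = Measure.infinitePi fun _ : ι => μ := by
    refine Measure.eq_infinitePi _ fun s t ht => ?_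
    rw [Measure.map_apply hm (MeasurableSet.pi s.countable_toSet fun i _ => ht i)]
    have hpre : (fun z : (ι → X) × X => Function.update z.1 u z.2) ⁻¹' Set.pi s t =
        (Set.pi (s.erase u : Finset ι) t) ×ˢ (if u ∈ s then t u else Set.univ) := by
      ext ⟨η, x⟩
      simp only [Set.mem_preimage, Set.mem_pi, Set.mem_prod, Finset.mem_coe, Finset.mem_erase]
      constructor
      · intro h
        refine ⟨fun i hi => by simpa [hi.1] using h i hi.2, ?_⟩
        split_ifs with hu
        · simpa using h u hu
        · trivial
      · rintro ⟨h1, h2⟩ i hi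
        by_cases hiu : i = u
        · subst hiu; simpa [hi] using h2
        · simpa [hiu] using h1 i ⟨hiu, hi⟩
    rw [hpre, Measure.prod_prod, Measure.infinitePi_pi _ fun i _ => ht i]
    split_ifs with hu
    · rw [mul_comm, Finset.mul_prod_erase s (fun i => μ (t i)) hu]
    · simp [Finset.erase_eq_of_notMem hu]
  conv_lhs => rw [← key]
  have hFm : Measurable fun z : (ι → X) × X => F (Function.update z.1 u z.2) := hF.comp hm
  rw [lintegral_map hF hm, lintegral_prod _ hFm.aemeasurable]

namespace RangeTree

lemma measurable_of_progeny {B : Type*} [MeasurableSpace B] {f : Progeny → B}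
    (h : ∀ n : ℕ∞, Measurable fun x : {i : ℕ // (i : ℕ∞) < n} → ℝ => f ⟨n, x⟩) : Measurable f := by
  intro s hs
  exact MeasurableSpace.measurableSet_iInf.2 fun n => h n hs

lemma measurable_weight (j : ℕ) : Measurable fun p : Progeny => p.weight j := by
  refine measurable_of_progeny fun n => ?_
  unfold Progeny.weight
  by_cases h : (j : ℕ∞) < n
  · simp only [h, dif_pos]
    have hx : Measurable fun x : {i : ℕ // (i : ℕ∞) < n} → ℝ => x ⟨j, h⟩ := measurable_pi_apply _
    exact (Real.measurable_exp.comp hx.neg).ennreal_ofReal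
  · simp only [h, dif_neg, not_false_eq_true, measurable_const]

lemma lintegral_offspringLaw (p : Progeny) (i : ℕ) {f : (ℕ → ℕ) → ℝ≥0∞} (hf : Measurable f) :
    ∫⁻ b, f b ∂offspringLaw p i = ∑' k : ℕ →₀ ℕ, negMultinomial p.weight i k * f k := by
  let _ : MeasurableSpace (ℕ →₀ ℕ) := ⊤
  have hm : Measurable fun (k : ℕ →₀ ℕ) (j : ℕ) => k j := measurable_from_top
  rw [offspringLaw, ← PMF.toMeasure_map _ _ hm, lintegral_map hf hm, lintegral_countable']
  refine tsum_congr fun k => ?_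
  rw [PMF.toMeasure_apply_singleton _ _ MeasurableSpace.measurableSet_top, mul_comm]

lemma negMultinomial_succ_apply {a : ℕ → ℝ≥0∞} (ha : ∑' j, a j ≠ ⊤) (i : ℕ) (k : ℕ →₀ ℕ) :
    negMultinomial a (i + 1) k = negMultinomialWeight a i k := by
  have h : negMultinomial a (i + 1) = (⟨negMultinomialWeight a i,
      tsum_negMultinomialWeight a ha i ▸ ENNReal.summable.hasSum⟩ : PMF (ℕ →₀ ℕ)) := dif_pos ha
  rw [h]
  rfl

lemma negMultinomial_of_tsum_eq_top {a : ℕ → ℝ≥0∞} (ha : ∑' j, a j = ⊤) (i : ℕ) :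
    negMultinomial a i = PMF.pure 0 := by
  cases i with
  | zero => rfl
  | succ i => exact dif_neg (not_not.2 ha)

lemma measurable_negMultinomial (i : ℕ) (k : ℕ →₀ ℕ) :
    Measurable fun p : Progeny => negMultinomial p.weight i k := by
  cases i with
  | zero => exact measurable_const
  | succ i =>
    have hS : Measurable fun p : Progeny => ∑' j, p.weight j :=
      Measurable.tsum measurable_weight
    have h : ∀ p : Progeny, negMultinomial p.weight (i + 1) k =
        if ∑' j, p.weight j ≠ ⊤ then negMultinomialWeight p.weight i k else PMF.pure 0 k := by
      intro p
      split_ifs with hp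
      · exact negMultinomial_succ_apply hp i k
      · rw [negMultinomial_of_tsum_eq_top (not_not.1 hp)]
    simp only [h]
    refine Measurable.ite (hS (measurableSet_singleton ⊤).compl) ?_ measurable_const
    unfold negMultinomialWeight
    refine Measurable.div (Measurable.const_mul ?_ _) ((measurable_const.add hS).pow_const _)
    unfold Finsupp.prod
    exact Finset.measurable_prod _ fun j _ => (measurable_weight j).pow_const _

lemma measurable_offspringLaw (i : ℕ) : Measurable fun p : Progeny => offspringLaw p i := by
  refine Measure.measurable_of_measurable_coe _ fun s hs => ?_
  have : ∀ p : Progeny, offspringLaw p i s =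
      ∑' k : ℕ →₀ ℕ, negMultinomial p.weight i k * s.indicator 1 (k : ℕ → ℕ) := by
    intro p
    rw [← lintegral_offspringLaw p i (measurable_one.indicator hs), lintegral_indicator_one hs]
  simp only [this]
  exact Measurable.tsum fun k => (measurable_negMultinomial i k).mul_const _

/-- All the randomness attached to one vertex: its progeny, and for each `i` the types of its
children if its own type is `i`. -/
abbrev Noise : Type := Progeny × (ℕ → ℕ → ℕ)

/-- The kernel giving, for a progeny, independent types of the children for all the possible types
of the parent. -/
noncomputable def typesKernel : Kernel Progeny (ℕ → ℕ → ℕ) where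
  toFun p := Measure.infinitePi fun i => offspringLaw p i
  measurable' := measurable_infinitePi_kernel _ measurable_offspringLaw

instance : IsMarkovKernel typesKernel := ⟨fun p => by
  change IsProbabilityMeasure (Measure.infinitePi fun i => offspringLaw p i); infer_instance⟩

/-- The law of the randomness attached to one vertex. -/
noncomputable def noiseLaw (N : Measure Progeny) [IsProbabilityMeasure N] : Measure Noise :=
  N ⊗ₘ typesKernel

instance (N : Measure Progeny) [IsProbabilityMeasure N] : IsProbabilityMeasure (noiseLaw N) := by
  unfold noiseLaw; infer_instance

/-- The joint law of environment and types on the space where the randomness attached to the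
different vertices is independent and identically distributed. -/
noncomputable def treeLaw (N : Measure Progeny) [IsProbabilityMeasure N] :
    Measure (Vertex → Noise) :=
  Measure.infinitePi fun _ => noiseLaw N

instance (N : Measure Progeny) [IsProbabilityMeasure N] : IsProbabilityMeasure (treeLaw N) := by
  unfold treeLaw; infer_instance

/-- The environment carried by the randomness of all vertices. -/
def envOf (η : Vertex → Noise) : Env := fun u => (η u).1

/-- The family of progeny types carried by the randomness of all vertices. -/
def typesOf (η : Vertex → Noise) : Vertex × ℕ → ℕ → ℕ := fun x => (η x.1).2 x.2

lemma measurable_envOf : Measurable envOf :=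
  measurable_pi_lambda _ fun u => measurable_fst.comp (measurable_pi_apply u)

lemma measurable_typesOf : Measurable typesOf :=
  measurable_pi_lambda _ fun x =>
    (measurable_pi_apply x.2).comp (measurable_snd.comp (measurable_pi_apply x.1))

/-- The kernel from environments to families of progeny types. -/
noncomputable def envTypesKernel : Kernel Env (Vertex × ℕ → ℕ → ℕ) where
  toFun ω := Measure.infinitePi fun x : Vertex × ℕ => offspringLaw (ω x.1) x.2
  measurable' := measurable_infinitePi_kernel _ fun x =>
    (measurable_offspringLaw x.2).comp (measurable_pi_apply x.1)

instance : IsMarkovKernel envTypesKernel := ⟨fun ω => by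
  change IsProbabilityMeasure (Measure.infinitePi fun x : Vertex × ℕ => offspringLaw (ω x.1) x.2)
  infer_instance⟩

instance (N : Measure Progeny) [IsProbabilityMeasure N] : IsProbabilityMeasure (brwLaw N) := by
  unfold brwLaw; infer_instance

/-- Attaching to each vertex its own progeny and its own family of types turns the joint law of
environment and types into a product law. -/
lemma map_compProd_eq_treeLaw (N : Measure Progeny) [IsProbabilityMeasure N] :
    (brwLaw N ⊗ₘ envTypesKernel).map
      (fun z u => ((z.1 u, fun i => z.2 (u, i)) : Noise)) = treeLaw N := by
  have hm : Measurable fun (z : Env × (Vertex × ℕ → ℕ → ℕ)) (u : Vertex) =>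
      ((z.1 u, fun i => z.2 (u, i)) : Noise) := by
    refine measurable_pi_lambda _ fun u => ((measurable_pi_apply u).comp measurable_fst).prodMk ?_
    exact measurable_pi_lambda _ fun i => (measurable_pi_apply _).comp measurable_snd
  unfold treeLaw
  refine Measure.eq_infinitePi _ fun s t ht => ?_
  have hpi : MeasurableSet (Set.pi (s : Set Vertex) t) :=
    MeasurableSet.pi s.countable_toSet fun i _ => ht i
  rw [Measure.map_apply hm hpi, Measure.compProd_apply (hm hpi)]
  have hinner : ∀ ω : Env, envTypesKernel ω (Prod.mk ω ⁻¹' ((fun (z : Env × (Vertex × ℕ → ℕ → ℕ))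
      (u : Vertex) => ((z.1 u, fun i => z.2 (u, i)) : Noise)) ⁻¹' Set.pi (s : Set Vertex) t)) =
      ∏ u ∈ s, typesKernel (ω u) (Prod.mk (ω u) ⁻¹' t u) := by
    intro ω
    have h1 := Measure.infinitePi_map_curry
      (fun (u : Vertex) (i : ℕ) => offspringLaw (ω u) i)
    have h2 := Measure.infinitePi_pi (s := s) (t := fun u => Prod.mk (ω u) ⁻¹' t u)
      (fun u : Vertex => Measure.infinitePi fun i : ℕ => offspringLaw (ω u) i)
      (fun u _ => measurable_prodMk_left (ht u))
    rw [← h1, Measure.map_apply (MeasurableEquiv.measurable _) (MeasurableSet.pi s.countable_toSet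
      fun u _ => measurable_prodMk_left (ht u))] at h2
    exact h2
  simp only [hinner]
  have hg : ∀ u, Measurable fun p : Progeny => typesKernel p (Prod.mk p ⁻¹' t u) := fun u =>
    Kernel.measurable_kernel_prodMk_left (ht u)
  have hind := iIndepFun_infinitePi (P := fun _ : Vertex => N) (X := fun u p =>
    typesKernel p (Prod.mk p ⁻¹' t u)) hg
  unfold brwLaw
  rw [lintegral_prod_eq_prod_lintegral_of_indepFun s _ hind
    fun u => (hg u).comp (measurable_pi_apply u)]
  refine Finset.prod_congr rfl fun u _ => ?_
  rw [noiseLaw, Measure.compProd_apply (ht u),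
    ← (measurePreserving_eval_infinitePi (fun _ : Vertex => N) u).lintegral_comp (hg u)]

lemma lintegral_compProd_eq_treeLaw (N : Measure Progeny) [IsProbabilityMeasure N]
    {F : Env × (Vertex × ℕ → ℕ → ℕ) → ℝ≥0∞} (hF : Measurable F) :
    ∫⁻ ω, ∫⁻ ξ, F (ω, ξ) ∂envTypesKernel ω ∂brwLaw N =
      ∫⁻ η, F (envOf η, typesOf η) ∂treeLaw N := by
  have hG : Measurable fun η : Vertex → Noise => F (envOf η, typesOf η) :=
    hF.comp (measurable_envOf.prodMk measurable_typesOf)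
  rw [← Measure.lintegral_compProd hF, ← map_compProd_eq_treeLaw, lintegral_map hG]
  · rfl
  · refine measurable_pi_lambda _ fun u => ((measurable_pi_apply u).comp measurable_fst).prodMk ?_
    exact measurable_pi_lambda _ fun i => (measurable_pi_apply _).comp measurable_snd

lemma lintegral_brwLaw_eq_treeLaw (N : Measure Progeny) [IsProbabilityMeasure N]
    {F : Env → ℝ≥0∞} (hF : Measurable F) :
    ∫⁻ ω, F ω ∂brwLaw N = ∫⁻ η, F (envOf η) ∂treeLaw N := by
  simpa using lintegral_compProd_eq_treeLaw N (hF.comp measurable_fst)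

lemma annealedExp_eq_treeLaw (N : Measure Progeny) [IsProbabilityMeasure N] (n : ℕ)
    {F : Env → (Vertex → ℕ) → ℝ≥0∞} (hF : Measurable fun z : Env × (Vertex → ℕ) => F z.1 z.2) :
    annealedExp N n F = ∫⁻ η, F (envOf η) (edgeLocalTime n (typesOf η)) ∂treeLaw N := by
  have hm : Measurable fun z : Env × (Vertex × ℕ → ℕ → ℕ) => F z.1 (edgeLocalTime n z.2) :=
    hF.comp (measurable_fst.prodMk ((measurable_edgeLocalTime n).comp measurable_snd))
  rw [← lintegral_compProd_eq_treeLaw N hm, annealedExp]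
  refine lintegral_congr fun ω => ?_
  have hω : Measurable fun β => F ω β := hF.comp measurable_prodMk_left
  rw [quenchedLaw, lintegral_map hω (measurable_edgeLocalTime n)]
  rfl

/-! ### Moments of negative multinomial laws -/


lemma multinomial_add_single (k : ℕ →₀ ℕ) (i j : ℕ) :
    (k j + 1) * (((k + Finsupp.single j 1).degree + i).choose i *
      (k + Finsupp.single j 1).multinomial) =
      (i + 1) * ((k.degree + (i + 1)).choose (i + 1) * k.multinomial) := by
  classical
  set k' := k + Finsupp.single j 1 with hk'
  set s := insert j k.support with hs
  have hks : k.support ⊆ s := Finset.subset_insert _ _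
  have hks' : k'.support ⊆ s := by
    refine Finsupp.support_add.trans (Finset.union_subset hks ?_)
    exact Finsupp.support_single_subset.trans (by simp [hs])
  have hd' : k'.degree = k.degree + 1 := by simp [hk']
  have sum_eq : ∀ l : ℕ →₀ ℕ, l.support ⊆ s → ∑ x ∈ s, l x = l.degree := by
    intro l hl
    rw [Finsupp.degree_apply, Finset.sum_subset hl]
    intro x _ hx
    simpa using hx
  have h1 := Nat.multinomial_spec s k
  have h2 := Nat.multinomial_spec s k'
  rw [← Finsupp.multinomial_eq_of_support_subset hks, sum_eq k hks] at h1
  rw [← Finsupp.multinomial_eq_of_support_subset hks', sum_eq k' hks', hd'] at h2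
  have hj : j ∈ s := Finset.mem_insert_self _ _
  have h3 : ∏ x ∈ s, (k' x).factorial = (k j + 1) * ∏ x ∈ s, (k x).factorial := by
    rw [← Finset.mul_prod_erase s _ hj, ← Finset.mul_prod_erase s (fun x => (k x).factorial) hj,
      ← mul_assoc]
    congr 1
    · simp [hk', Nat.factorial_succ]
    · refine Finset.prod_congr rfl fun x hx => ?_
      have : x ≠ j := Finset.ne_of_mem_erase hx
      simp [hk', this.symm]
  rw [h3] at h2
  have h4 := Nat.add_choose_mul_factorial_mul_factorial (k.degree + 1) i
  have h5 := Nat.add_choose_mul_factorial_mul_factorial k.degree (i + 1)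
  have hpos : 0 < (∏ x ∈ s, (k x).factorial) * i.factorial :=
    Nat.mul_pos (Finset.prod_pos fun x _ => Nat.factorial_pos _) (Nat.factorial_pos _)
  refine Nat.eq_of_mul_eq_mul_left hpos ?_
  rw [hd']
  calc _ = ((k.degree + 1 + i).choose i) * ((k j + 1) * (∏ x ∈ s, (k x).factorial) *
        k'.multinomial) * i.factorial := by ring
    _ = (k.degree + 1 + i).factorial := by rw [h2, h4]
    _ = (k.degree + (i + 1)).factorial := by congr 1; ring
    _ = ((k.degree + (i + 1)).choose (i + 1)) * ((∏ x ∈ s, (k x).factorial) *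
        k.multinomial) * (i + 1).factorial := by rw [h1, h5]
    _ = _ := by rw [Nat.factorial_succ]; ring

lemma negMultinomialWeight_add_single (a : ℕ → ℝ≥0∞) (i j : ℕ) (k : ℕ →₀ ℕ) :
    ((k j + 1 : ℕ) : ℝ≥0∞) * negMultinomialWeight a i (k + Finsupp.single j 1) =
      (i + 1 : ℕ) * a j * negMultinomialWeight a (i + 1) k := by
  have hprod : ((k + Finsupp.single j 1).prod fun j m => a j ^ m) =
      (k.prod fun j m => a j ^ m) * a j := by
    rw [Finsupp.prod_add_index' (by simp) (by simp [pow_add])]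
    simp
  have hnat := congrArg (Nat.cast : ℕ → ℝ≥0∞) (multinomial_add_single k i j)
  rw [Nat.cast_mul, Nat.cast_mul (i + 1)] at hnat
  have hd : (k + Finsupp.single j 1).degree + i + 1 = k.degree + (i + 1) + 1 := by
    simp; ring
  unfold negMultinomialWeight
  rw [hprod, hd, div_eq_mul_inv, div_eq_mul_inv, ← mul_assoc, ← mul_assoc, hnat]
  ring

/-- Size biasing a negative multinomial law by its `j`-th component adds one trial, and one to this
component. -/
lemma tsum_negMultinomial_mul {a : ℕ → ℝ≥0∞} (ha : ∑' j, a j ≠ ⊤) (i j : ℕ)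
    (f : (ℕ →₀ ℕ) → ℝ≥0∞) :
    ∑' k, negMultinomial a i k * (k j * f k) =
      i * a j * ∑' k, negMultinomial a (i + 1) k * f (k + Finsupp.single j 1) := by
  classical
  cases i with
  | zero =>
    rw [Nat.cast_zero, zero_mul, zero_mul, ENNReal.tsum_eq_zero]
    intro k
    by_cases hk : k = 0
    · simp [hk]
    · simp [negMultinomial, PMF.pure_apply, hk]
  | succ i =>
    have hinj : Function.Injective fun k : ℕ →₀ ℕ => k + Finsupp.single j 1 :=
      add_left_injective _
    rw [← hinj.tsum_eq, ← ENNReal.tsum_mul_left]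
    · refine tsum_congr fun k => ?_
      rw [negMultinomial_succ_apply ha, negMultinomial_succ_apply ha]
      have := negMultinomialWeight_add_single a i j k
      calc _ = ((k j + 1 : ℕ) : ℝ≥0∞) * negMultinomialWeight a i (k + Finsupp.single j 1) *
            f (k + Finsupp.single j 1) := by simp; ring
        _ = _ := by rw [this]; ring
    · intro k hk
      have hkj : k j ≠ 0 := by
        intro h
        simp [h] at hk
      refine ⟨k - Finsupp.single j 1, ?_⟩
      ext x
      by_cases hx : x = j
      · subst hx; simp; omega
      · simp [Ne.symm hx]

lemma tsum_negMultinomial_linear {a : ℕ → ℝ≥0∞} (ha : ∑' j, a j ≠ ⊤) (c : ℕ → ℝ≥0∞) (i : ℕ) :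
    ∑' k : ℕ →₀ ℕ, negMultinomial a i k * ∑' j, c j * k j = i * ∑' j, c j * a j := by
  simp_rw [← ENNReal.tsum_mul_left]
  rw [ENNReal.tsum_comm]
  refine tsum_congr fun j => ?_
  have h := tsum_negMultinomial_mul ha i j fun _ => c j
  rw [ENNReal.tsum_mul_right, PMF.tsum_coe, one_mul] at h
  calc _ = ∑' k, negMultinomial a i k * (k j * c j) := tsum_congr fun k => by ring
    _ = _ := by rw [h]; ring

lemma tsum_negMultinomial_sq {a : ℕ → ℝ≥0∞} (ha : ∑' j, a j ≠ ⊤) {c : ℕ → ℝ≥0∞}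
    (hc : ∀ j, c j * c j = c j) (i : ℕ) :
    ∑' k : ℕ →₀ ℕ, negMultinomial a i k * (∑' j, c j * k j) ^ 2 =
      i * (∑' j, c j * a j) * (1 + (i + 1) * ∑' j, c j * a j) := by
  set A := ∑' j, c j * a j with hA
  have h0 : ∀ k : ℕ →₀ ℕ, negMultinomial a i k * (∑' j, c j * k j) ^ 2 =
      ∑' j, c j * (negMultinomial a i k * (k j * ∑' l, c l * k l)) := by
    intro k
    rw [sq, ← mul_assoc, mul_right_comm, ← ENNReal.tsum_mul_left]
    refine tsum_congr fun j => ?_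
    ring
  simp_rw [h0]
  rw [ENNReal.tsum_comm]
  have h1 : ∀ j, ∑' k, c j * (negMultinomial a i k * (k j * ∑' l, c l * k l)) =
      i * (c j * a j) * (1 + (i + 1) * A) := by
    intro j
    rw [ENNReal.tsum_mul_left, tsum_negMultinomial_mul ha i j fun k => ∑' l, c l * k l]
    have h2 : ∀ k : ℕ →₀ ℕ, ∑' l, c l * ((k + Finsupp.single j 1 : ℕ →₀ ℕ) l : ℝ≥0∞) =
        (∑' l, c l * k l) + c j := by
      intro k
      simp only [Finsupp.add_apply, Nat.cast_add, mul_add]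
      rw [ENNReal.tsum_add]
      congr 1
      rw [tsum_eq_single j]
      · simp
      · intro l hl
        simp [hl.symm]
    simp_rw [h2, mul_add]
    rw [ENNReal.tsum_add, tsum_negMultinomial_linear ha, ENNReal.tsum_mul_right, PMF.tsum_coe]
    calc _ = ((i + 1 : ℕ) * A) * (i * (c j * a j)) + (c j * c j) * (i * a j) := by ring
      _ = _ := by rw [hc]; push_cast; ring
  simp_rw [h1]
  rw [ENNReal.tsum_mul_right, ENNReal.tsum_mul_left]

lemma measurable_linear (c : ℕ → ℝ≥0∞) : Measurable fun b : ℕ → ℕ => ∑' j, c j * (b j : ℝ≥0∞) := by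
  refine Measurable.tsum fun j => Measurable.const_mul ?_ _
  exact (measurable_from_top (f := fun n : ℕ => (n : ℝ≥0∞))).comp (measurable_pi_apply j)

lemma lintegral_offspringLaw_linear {p : Progeny} (hp : ∑' j, p.weight j ≠ ⊤) (c : ℕ → ℝ≥0∞)
    (i : ℕ) :
    ∫⁻ b, ∑' j, c j * (b j : ℝ≥0∞) ∂offspringLaw p i = i * ∑' j, c j * p.weight j := by
  rw [lintegral_offspringLaw p i (measurable_linear c), tsum_negMultinomial_linear hp]

lemma lintegral_offspringLaw_sq {p : Progeny} (hp : ∑' j, p.weight j ≠ ⊤) {c : ℕ → ℝ≥0∞}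
    (hc : ∀ j, c j * c j = c j) (i : ℕ) :
    ∫⁻ b, (∑' j, c j * (b j : ℝ≥0∞)) ^ 2 ∂offspringLaw p i =
      i * (∑' j, c j * p.weight j) * (1 + (i + 1) * ∑' j, c j * p.weight j) := by
  rw [lintegral_offspringLaw p i ((measurable_linear c).pow_const 2),
    tsum_negMultinomial_sq hp hc]

/-! ### Interpolation of moments -/

lemma absDiff_le_add (x y : ℝ≥0∞) : absDiff x y ≤ x + y :=
  add_le_add tsub_le_self tsub_le_self

lemma absDiff_sq_add {x y : ℝ≥0∞} (hy : y ≠ ⊤) : absDiff x y ^ 2 + 2 * (x * y) = x ^ 2 + y ^ 2 := by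
  unfold absDiff
  rcases le_total x y with h | h
  · rw [tsub_eq_zero_of_le h, zero_add]
    obtain ⟨d, rfl⟩ := exists_add_of_le h
    rw [ENNReal.add_sub_cancel_left (ne_top_of_le_ne_top hy h)]
    ring
  · rw [tsub_eq_zero_of_le h, add_zero]
    obtain ⟨d, rfl⟩ := exists_add_of_le h
    rw [ENNReal.add_sub_cancel_left hy]
    ring

lemma lintegral_rpow_le_interpolate {Ω : Type*} [MeasurableSpace Ω] {ν : Measure Ω}
    {f : Ω → ℝ≥0∞} (hf : Measurable f) {r : ℝ} (h1 : 1 ≤ r) (h2 : r ≤ 2) :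
    ∫⁻ ω, f ω ^ r ∂ν ≤ (∫⁻ ω, f ω ∂ν) ^ (2 - r) * (∫⁻ ω, f ω ^ 2 ∂ν) ^ (r - 1) := by
  have h := ENNReal.lintegral_mul_norm_pow_le (μ := ν) hf.aemeasurable
    (hf.pow_const 2).aemeasurable (p := 2 - r) (q := r - 1) (by linarith) (by linarith) (by ring)
  refine le_trans (le_of_eq (lintegral_congr fun ω => ?_)) h
  rw [← ENNReal.rpow_natCast, ← ENNReal.rpow_mul, ← ENNReal.rpow_add_of_nonneg _ _ (by linarith)
    (by push_cast; linarith)]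
  congr 1; push_cast; ring

section

variable {Ω : Type*} [MeasurableSpace Ω] {ν : Measure Ω} {X : Ω → ℝ≥0∞}
  {A : ℝ≥0∞} {i : ℕ}

/-- Moments between the first and the second one, for a variable whose first two moments are those
of a sum of `i` independent geometric variables of mean `A`. -/
lemma lintegral_rpow_le_of_moments (hX : Measurable X)
    (h1 : ∫⁻ ω, X ω ∂ν = i * A) (h2 : ∫⁻ ω, X ω ^ 2 ∂ν = i * A * (1 + (i + 1) * A))
    {r : ℝ} (hr1 : 1 ≤ r) (hr2 : r ≤ 2) :
    ∫⁻ ω, X ω ^ r ∂ν ≤ i * A + i * (i + 1) ^ (r - 1) * A ^ r := by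
  refine (lintegral_rpow_le_interpolate hX hr1 hr2).trans ?_
  rw [h1, h2, ENNReal.mul_rpow_of_nonneg _ _ (by linarith : 0 ≤ r - 1), ← mul_assoc,
    ← ENNReal.rpow_add_of_nonneg _ _ (by linarith) (by linarith)]
  have e : 2 - r + (r - 1) = 1 := by ring
  rw [e, ENNReal.rpow_one]
  have hA : A ^ r = A * A ^ (r - 1) := by
    conv_rhs => enter [1]; rw [← ENNReal.rpow_one A]
    rw [← ENNReal.rpow_add_of_nonneg _ _ zero_le_one (by linarith)]
    congr 1; ring
  calc (i : ℝ≥0∞) * A * (1 + (i + 1) * A) ^ (r - 1)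
      ≤ i * A * (1 ^ (r - 1) + ((i + 1) * A) ^ (r - 1)) := by
        gcongr
        exact ENNReal.rpow_add_le_add_rpow _ _ (by linarith) (by linarith)
    _ = _ := by
        rw [ENNReal.one_rpow, ENNReal.mul_rpow_of_nonneg _ _ (by linarith : 0 ≤ r - 1), hA]
        ring

lemma lintegral_absDiff_rpow_le_of_moments [IsProbabilityMeasure ν] (hX : Measurable X) (hA : A ≠ ⊤)
    (h1 : ∫⁻ ω, X ω ∂ν = i * A) (h2 : ∫⁻ ω, X ω ^ 2 ∂ν = i * A * (1 + (i + 1) * A))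
    {r : ℝ} (hr1 : 1 ≤ r) (hr2 : r ≤ 2) :
    ∫⁻ ω, absDiff (X ω) (i * A) ^ r ∂ν ≤ 2 * i * (A + A ^ r) := by
  have hm : (i : ℝ≥0∞) * A ≠ ⊤ := ENNReal.mul_ne_top (ENNReal.natCast_ne_top i) hA
  have hmeas : Measurable fun ω => absDiff (X ω) (i * A) :=
    (hX.sub measurable_const).add (measurable_const.sub hX)
  have e1 : ∫⁻ ω, absDiff (X ω) (i * A) ∂ν ≤ 2 * (i * A) := by
    refine (lintegral_mono fun ω => absDiff_le_add _ _).trans (le_of_eq ?_)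
    rw [lintegral_add_left hX, h1, lintegral_const, measure_univ, mul_one, two_mul]
  have e2 : ∫⁻ ω, absDiff (X ω) (i * A) ^ 2 ∂ν = i * A * (1 + A) := by
    have h3 : ∫⁻ ω, (absDiff (X ω) (i * A) ^ 2 + 2 * (X ω * (i * A))) ∂ν =
        ∫⁻ ω, (X ω ^ 2 + (i * A) ^ 2) ∂ν := lintegral_congr fun ω => absDiff_sq_add hm
    rw [lintegral_add_left (hmeas.pow_const 2), lintegral_add_left (hX.pow_const 2), h2,
      lintegral_const_mul _ (hX.mul_const _), lintegral_mul_const _ hX, h1, lintegral_const,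
      measure_univ, mul_one] at h3
    have h4 : i * A * (1 + (i + 1) * A) + (i * A) ^ 2 = i * A * (1 + A) + 2 * (i * A * (i * A)) := by
      ring
    rw [h4] at h3
    exact (ENNReal.add_left_inj (ENNReal.mul_ne_top (by simp) (ENNReal.mul_ne_top hm hm))).1 h3
  refine (lintegral_rpow_le_interpolate hmeas hr1 hr2).trans ?_
  have hAr : A ^ r = A * A ^ (r - 1) := by
    conv_rhs => enter [1]; rw [← ENNReal.rpow_one A]
    rw [← ENNReal.rpow_add_of_nonneg _ _ zero_le_one (by linarith)]
    congr 1; ring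
  have e : 2 - r + (r - 1) = 1 := by ring
  have two_le : (2 : ℝ≥0∞) ^ (2 - r) ≤ 2 := by
    conv_rhs => rw [← ENNReal.rpow_one 2]
    exact ENNReal.rpow_le_rpow_of_exponent_le (by norm_num) (by linarith)
  calc (∫⁻ ω, absDiff (X ω) (i * A) ∂ν) ^ (2 - r) *
        (∫⁻ ω, absDiff (X ω) (i * A) ^ 2 ∂ν) ^ (r - 1)
      ≤ (2 * (i * A)) ^ (2 - r) * (i * A * (1 + A)) ^ (r - 1) := by
        rw [e2]
        gcongr
    _ = 2 ^ (2 - r) * ((i * A) * (1 + A) ^ (r - 1)) := by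
        rw [ENNReal.mul_rpow_of_nonneg _ _ (by linarith : 0 ≤ 2 - r),
          ENNReal.mul_rpow_of_nonneg _ _ (by linarith : 0 ≤ r - 1), mul_assoc,
          ← mul_assoc ((i * A) ^ (2 - r)),
          ← ENNReal.rpow_add_of_nonneg _ _ (by linarith) (by linarith), e, ENNReal.rpow_one]
    _ ≤ 2 * ((i * A) * (1 ^ (r - 1) + A ^ (r - 1))) := by
        gcongr
        exact ENNReal.rpow_add_le_add_rpow _ _ (by linarith) (by linarith)
    _ = _ := by rw [ENNReal.one_rpow, hAr]; ring

end

/-! ### The Laplace transform -/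


lemma sum_exp_eq_tsum_weight_rpow (p : Progeny) {t : ℝ} (ht : 0 < t) :
    p.sum (fun x => ENNReal.ofReal (Real.exp (-(t * x)))) = ∑' j, p.weight j ^ t := by
  unfold Progeny.sum
  rw [← Subtype.val_injective.tsum_eq (f := fun j => p.weight j ^ t)
    (g := (Subtype.val : {i : ℕ // (i : ℕ∞) < p.1} → ℕ))]
  · refine tsum_congr fun j => ?_
    rw [Progeny.weight, dif_pos j.2, ENNReal.ofReal_rpow_of_pos (Real.exp_pos _), ← Real.exp_mul]
    ring_nf
  · intro j hj
    by_contra h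
    have hlt : ¬ (j : ℕ∞) < p.1 := fun hlt => h ⟨⟨j, hlt⟩, rfl⟩
    exact hj (by simp [Progeny.weight, hlt, ht])

lemma sum_exp_eq_tsum_weight (p : Progeny) :
    p.sum (fun x => ENNReal.ofReal (Real.exp (-x))) = ∑' j, p.weight j := by
  simpa using sum_exp_eq_tsum_weight_rpow p one_pos

lemma weight_ne_top (p : Progeny) (j : ℕ) : p.weight j ≠ ⊤ := by
  unfold Progeny.weight
  split_ifs <;> simp

lemma measurable_tsum_weight : Measurable fun p : Progeny => ∑' j, p.weight j :=
  Measurable.tsum measurable_weight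

variable {N : Measure Progeny}

lemma psi_eq_lintegral_tsum {t : ℝ} (ht : 0 < t) :
    psi N t = ∫⁻ p, ∑' j, p.weight j ^ t ∂N :=
  lintegral_congr fun p => sum_exp_eq_tsum_weight_rpow p ht

lemma psi_eq_tsum_lintegral {t : ℝ} (ht : 0 < t) :
    psi N t = ∑' j, ∫⁻ p, p.weight j ^ t ∂N := by
  rw [psi_eq_lintegral_tsum ht, lintegral_tsum fun j => ((measurable_weight j).pow_const t).aemeasurable]

lemma psi_one_eq : psi N 1 = ∫⁻ p, ∑' j, p.weight j ∂N := by
  simp [psi_eq_lintegral_tsum one_pos]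

lemma psi_lt_one {κ : ℝ} (hκ : kappa N = (κ : EReal)) {t : ℝ} (h1 : 1 < t) (h2 : t < κ) :
    psi N t < 1 := by
  by_contra h
  have hle : kappa N ≤ (t : EReal) := sInf_le ⟨t, ⟨h1, not_lt.1 h⟩, rfl⟩
  rw [hκ, EReal.coe_le_coe_iff] at hle
  linarith

/-- `ψ(1) = 1`: by criticality `ψ(1) ≥ 1`, and `ψ` is lower semicontinuous by Fatou's lemma. -/
lemma psi_one {κ : ℝ} (hκ : kappa N = (κ : EReal)) (hκ1 : 1 < κ) (hc : HypC N) : psi N 1 = 1 := by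
  refine le_antisymm ?_ (hc.min_eq_one.2 ⟨1, by simp, rfl⟩)
  have ht : Tendsto (fun n : ℕ => 1 + (κ - 1) * (1 / ((n : ℝ) + 1)) * (1 / 2)) atTop (𝓝 1) := by
    have := ((tendsto_one_div_add_atTop_nhds_zero_nat (𝕜 := ℝ)).const_mul (κ - 1)).mul_const (1 / 2)
    simpa using this.const_add 1
  set t : ℕ → ℝ := fun n => 1 + (κ - 1) * (1 / ((n : ℝ) + 1)) * (1 / 2) with htdef
  have hpos : ∀ n : ℕ, 0 < 1 / ((n : ℝ) + 1) ∧ 1 / ((n : ℝ) + 1) ≤ 1 := fun n =>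
    ⟨by positivity, by rw [div_le_one (by positivity)]; linarith [n.cast_nonneg (α := ℝ)]⟩
  have ht1 : ∀ n, 1 < t n := fun n => by
    have := mul_pos (sub_pos.2 hκ1) (hpos n).1
    simp only [htdef]; linarith
  have ht2 : ∀ n, t n < κ := fun n => by
    have := mul_le_mul_of_nonneg_left (hpos n).2 (sub_pos.2 hκ1).le
    simp only [htdef]; linarith
  have hw : ∀ (p : Progeny) (j : ℕ), Tendsto (fun n => p.weight j ^ t n) atTop (𝓝 (p.weight j)) := by
    intro p j
    by_cases h : (j : ℕ∞) < p.1
    · have e : ∀ s : ℝ, p.weight j ^ s = ENNReal.ofReal (Real.exp (-p.2 ⟨j, h⟩ * s)) := by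
        intro s
        rw [Progeny.weight, dif_pos h, ENNReal.ofReal_rpow_of_pos (Real.exp_pos _), Real.exp_mul]
      have e1 : p.weight j = ENNReal.ofReal (Real.exp (-p.2 ⟨j, h⟩ * 1)) := by
        rw [← e 1, ENNReal.rpow_one]
      have hlim := ENNReal.tendsto_ofReal
        ((Real.continuous_exp.tendsto _).comp (ht.const_mul (-p.2 ⟨j, h⟩)))
      rw [← e1] at hlim
      exact hlim.congr fun n => (e (t n)).symm
    · have e : p.weight j = 0 := by simp [Progeny.weight, h]
      rw [e]
      refine tendsto_const_nhds.congr fun n => ?_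
      rw [ENNReal.zero_rpow_of_pos (by linarith [ht1 n])]
  rw [psi_eq_tsum_lintegral one_pos, ENNReal.tsum_eq_iSup_sum]
  refine iSup_le fun s => ?_
  rw [← lintegral_finsetSum _ fun j _ => (measurable_weight j).pow_const 1]
  calc ∫⁻ p, ∑ j ∈ s, p.weight j ^ (1 : ℝ) ∂N
      = ∫⁻ p, liminf (fun n => ∑ j ∈ s, p.weight j ^ t n) atTop ∂N := by
        refine lintegral_congr fun p => ?_
        simp only [ENNReal.rpow_one]
        exact (tendsto_finsetSum s fun j _ => hw p j).liminf_eq.symm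
    _ ≤ liminf (fun n => ∫⁻ p, ∑ j ∈ s, p.weight j ^ t n ∂N) atTop :=
        lintegral_liminf_le fun n => Finset.measurable_sum _ fun j _ =>
          (measurable_weight j).pow_const _
    _ ≤ 1 := by
        refine liminf_le_of_le (by isBoundedDefault) fun b hb => ?_
        obtain ⟨n, hn⟩ := hb.exists
        refine hn.trans (le_trans ?_ (psi_lt_one hκ (ht1 n) (ht2 n)).le)
        rw [psi_eq_lintegral_tsum (by linarith [ht1 n])]
        exact lintegral_mono fun p => ENNReal.sum_le_tsum s

lemma lintegral_tsum_weight_rpow_lt_top [IsProbabilityMeasure N] {κ r : ℝ} (hk : HypKappa N κ)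
    (hr : 0 ≤ r) (hrκ : r ≤ κ) : ∫⁻ p, (∑' j, p.weight j) ^ r ∂N < ⊤ := by
  have hm := hk.moment
  simp only [sum_exp_eq_tsum_weight] at hm
  have hle : ∫⁻ p, (∑' j, p.weight j) ^ r ∂N ≤ ∫⁻ p, (1 + (∑' j, p.weight j) ^ κ) ∂N := by
    refine lintegral_mono fun p => ?_
    rcases le_total (∑' j, p.weight j) 1 with h | h
    · exact (ENNReal.rpow_le_one h hr).trans le_self_add
    · exact (ENNReal.rpow_le_rpow_of_exponent_le h hrκ).trans le_add_self
  refine hle.trans_lt ?_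
  rw [lintegral_add_left measurable_const]
  simpa using hm

/-! ### Moments of the types of the children -/

variable [IsProbabilityMeasure N]

lemma lintegral_noiseLaw_fst {g : Progeny → ℝ≥0∞} (hg : Measurable g) :
    ∫⁻ z, g z.1 ∂noiseLaw N = ∫⁻ p, g p ∂N := by
  have hm : Measurable fun z : Noise => g z.1 := hg.comp measurable_fst
  rw [noiseLaw, Measure.lintegral_compProd hm]
  simp

lemma lintegral_noiseLaw_type (i : ℕ) {g : Progeny × (ℕ → ℕ) → ℝ≥0∞} (hg : Measurable g) :
    ∫⁻ z, g (z.1, z.2 i) ∂noiseLaw N = ∫⁻ p, ∫⁻ b, g (p, b) ∂offspringLaw p i ∂N := by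
  have hm : Measurable fun z : Noise => g (z.1, z.2 i) :=
    hg.comp (measurable_fst.prodMk ((measurable_pi_apply i).comp measurable_snd))
  rw [noiseLaw, Measure.lintegral_compProd hm]
  refine lintegral_congr fun p => ?_
  exact (measurePreserving_eval_infinitePi (fun i => offspringLaw p i) i).lintegral_comp
    (hg.comp measurable_prodMk_left)

omit [IsProbabilityMeasure N] in
lemma ae_tsum_weight_ne_top (h1 : psi N 1 = 1) : ∀ᵐ p ∂N, ∑' j, p.weight j ≠ ⊤ := by
  have h : ∫⁻ p, ∑' j, p.weight j ∂N ≠ ⊤ := by rw [← psi_one_eq, h1]; simp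
  filter_upwards [ae_lt_top measurable_tsum_weight h] with p hp using hp.ne

lemma measurable_natCast_apply (j : ℕ) : Measurable fun b : ℕ → ℕ => (b j : ℝ≥0∞) :=
  (measurable_from_top (f := fun n : ℕ => (n : ℝ≥0∞))).comp (measurable_pi_apply j)

lemma tsum_single_mul (j : ℕ) (f : ℕ → ℝ≥0∞) :
    ∑' l, (if l = j then (1 : ℝ≥0∞) else 0) * f l = f j := by
  rw [tsum_eq_single j fun l hl => by simp [hl]]
  simp

lemma lintegral_offspringLaw_apply {p : Progeny} (hp : ∑' j, p.weight j ≠ ⊤) (i j : ℕ) :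
    ∫⁻ b, (b j : ℝ≥0∞) ∂offspringLaw p i = i * p.weight j := by
  simpa only [tsum_single_mul] using
    lintegral_offspringLaw_linear hp (fun l => if l = j then (1 : ℝ≥0∞) else 0) i

lemma lintegral_offspringLaw_apply_sq {p : Progeny} (hp : ∑' j, p.weight j ≠ ⊤) (i j : ℕ) :
    ∫⁻ b, (b j : ℝ≥0∞) ^ 2 ∂offspringLaw p i =
      i * p.weight j * (1 + (i + 1) * p.weight j) := by
  simpa only [tsum_single_mul] using
    lintegral_offspringLaw_sq hp (c := fun l => if l = j then (1 : ℝ≥0∞) else 0)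
      (fun l => by split_ifs <;> simp) i

lemma measurable_type (i j : ℕ) : Measurable fun z : Noise => (z.2 i j : ℝ≥0∞) :=
  (measurable_natCast_apply j).comp ((measurable_pi_apply i).comp measurable_snd)

lemma lintegral_tsum_type (h1 : psi N 1 = 1) (i : ℕ) :
    ∫⁻ z, ∑' j, (z.2 i j : ℝ≥0∞) ∂noiseLaw N = i := by
  have hm : Measurable fun z : Progeny × (ℕ → ℕ) => ∑' j, (z.2 j : ℝ≥0∞) :=
    Measurable.tsum fun j => (measurable_natCast_apply j).comp measurable_snd
  rw [lintegral_noiseLaw_type i hm]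
  have h : ∀ᵐ p ∂N, ∫⁻ b, ∑' j, (b j : ℝ≥0∞) ∂offspringLaw p i = i * ∑' j, p.weight j := by
    filter_upwards [ae_tsum_weight_ne_top h1] with p hp
    simpa using lintegral_offspringLaw_linear hp (fun _ => 1) i
  rw [lintegral_congr_ae h, lintegral_const_mul _ measurable_tsum_weight, ← psi_one_eq, h1, mul_one]

lemma lintegral_tsum_type_rpow_le (h1 : psi N 1 = 1) (i : ℕ) {r : ℝ} (hr1 : 1 ≤ r) (hr2 : r ≤ 2) :
    ∫⁻ z, ∑' j, (z.2 i j : ℝ≥0∞) ^ r ∂noiseLaw N ≤ i + i * (i + 1) ^ (r - 1) * psi N r := by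
  rw [lintegral_tsum fun j => ((measurable_type i j).pow_const r).aemeasurable,
    psi_eq_tsum_lintegral (by linarith), ← ENNReal.tsum_mul_left]
  have h1' : (i : ℝ≥0∞) = ∑' j, i * ∫⁻ p, p.weight j ∂N := by
    rw [ENNReal.tsum_mul_left, ← lintegral_tsum fun j => (measurable_weight j).aemeasurable,
      ← psi_one_eq, h1, mul_one]
  conv_rhs => enter [1]; rw [h1']
  rw [← ENNReal.tsum_add]
  refine ENNReal.tsum_le_tsum fun j => ?_
  have hm : Measurable fun z : Progeny × (ℕ → ℕ) => (z.2 j : ℝ≥0∞) ^ r :=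
    ((measurable_natCast_apply j).comp measurable_snd).pow_const r
  rw [lintegral_noiseLaw_type i hm, ← lintegral_const_mul _ (measurable_weight j),
    ← lintegral_const_mul _ ((measurable_weight j).pow_const r),
    ← lintegral_add_left ((measurable_weight j).const_mul _)]
  refine lintegral_mono_ae ?_
  filter_upwards [ae_tsum_weight_ne_top h1] with p hp
  exact lintegral_rpow_le_of_moments (measurable_natCast_apply j)
    (lintegral_offspringLaw_apply hp i j) (lintegral_offspringLaw_apply_sq hp i j) hr1 hr2

lemma measurable_absDiff {B : Type*} [MeasurableSpace B] {f g : B → ℝ≥0∞} (hf : Measurable f)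
    (hg : Measurable g) : Measurable fun x => absDiff (f x) (g x) :=
  (hf.sub hg).add (hg.sub hf)

lemma lintegral_tsum_absDiff_type_le (h1 : psi N 1 = 1) (i : ℕ) {r : ℝ} (hr1 : 1 ≤ r)
    (hr2 : r ≤ 2) :
    ∫⁻ z, ∑' j, absDiff (z.2 i j) (i * z.1.weight j) ^ r ∂noiseLaw N ≤ 2 * i * (1 + psi N r) := by
  have hm : ∀ j, Measurable fun z : Progeny × (ℕ → ℕ) =>
      absDiff (z.2 j : ℝ≥0∞) (i * z.1.weight j) ^ r := fun j => by
    have h1 : Measurable fun z : Progeny × (ℕ → ℕ) => (z.2 j : ℝ≥0∞) :=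
      (measurable_natCast_apply j).comp measurable_snd
    have h2 : Measurable fun z : Progeny × (ℕ → ℕ) => (i : ℝ≥0∞) * z.1.weight j :=
      ((measurable_weight j).comp measurable_fst).const_mul _
    exact (measurable_absDiff h1 h2).pow_const r
  have hm' : ∀ j, Measurable fun z : Noise =>
      absDiff (z.2 i j : ℝ≥0∞) (i * z.1.weight j) ^ r := fun j => by
    have h2 : Measurable fun z : Noise => (i : ℝ≥0∞) * z.1.weight j :=
      ((measurable_weight j).comp measurable_fst).const_mul _
    exact (measurable_absDiff (measurable_type i j) h2).pow_const r
  have hrhs : 2 * (i : ℝ≥0∞) * (1 + psi N r) =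
      ∑' j, ∫⁻ p, 2 * i * (p.weight j + p.weight j ^ r) ∂N := by
    have hj : ∀ j, ∫⁻ p, 2 * (i : ℝ≥0∞) * (p.weight j + p.weight j ^ r) ∂N =
        2 * i * (∫⁻ p, p.weight j ∂N + ∫⁻ p, p.weight j ^ r ∂N) := fun j => by
      have hmj := (measurable_weight j).add ((measurable_weight j).pow_const r)
      rw [← lintegral_add_left (measurable_weight j)]
      exact lintegral_const_mul _ hmj
    simp_rw [hj]
    rw [ENNReal.tsum_mul_left, ENNReal.tsum_add, ← psi_eq_tsum_lintegral (t := r) (by linarith),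
      ← lintegral_tsum fun j => (measurable_weight j).aemeasurable, ← psi_one_eq, h1]
  rw [lintegral_tsum fun j => (hm' j).aemeasurable, hrhs]
  refine ENNReal.tsum_le_tsum fun j => ?_
  rw [lintegral_noiseLaw_type i (hm j)]
  refine lintegral_mono_ae ?_
  filter_upwards [ae_tsum_weight_ne_top h1] with p hp
  exact lintegral_absDiff_rpow_le_of_moments (measurable_natCast_apply j) (weight_ne_top p j)
    (lintegral_offspringLaw_apply hp i j) (lintegral_offspringLaw_apply_sq hp i j) hr1 hr2

lemma lintegral_absDiff_tsum_type_le (h1 : psi N 1 = 1) (i : ℕ) {r : ℝ} (hr1 : 1 ≤ r)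
    (hr2 : r ≤ 2) :
    ∫⁻ z, absDiff (∑' j, (z.2 i j : ℝ≥0∞)) (i * ∑' j, z.1.weight j) ^ r ∂noiseLaw N ≤
      2 * i * (1 + ∫⁻ p, (∑' j, p.weight j) ^ r ∂N) := by
  have hZ : Measurable fun b : ℕ → ℕ => ∑' j, (b j : ℝ≥0∞) :=
    Measurable.tsum fun j => measurable_natCast_apply j
  have hm : Measurable fun z : Progeny × (ℕ → ℕ) =>
      absDiff (∑' j, (z.2 j : ℝ≥0∞)) (i * ∑' j, z.1.weight j) ^ r :=
    (measurable_absDiff (hZ.comp measurable_snd)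
      ((measurable_tsum_weight.comp measurable_fst).const_mul _)).pow_const r
  have hrhs : 2 * (i : ℝ≥0∞) * (1 + ∫⁻ p, (∑' j, p.weight j) ^ r ∂N) =
      ∫⁻ p, 2 * i * (∑' j, p.weight j + (∑' j, p.weight j) ^ r) ∂N := by
    have hms := measurable_tsum_weight.add (measurable_tsum_weight.pow_const r)
    rw [show (1 : ℝ≥0∞) = ∫⁻ p, ∑' j, p.weight j ∂N by rw [← psi_one_eq, h1],
      ← lintegral_add_left measurable_tsum_weight]
    exact (lintegral_const_mul _ hms).symm
  rw [lintegral_noiseLaw_type i hm, hrhs]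
  refine lintegral_mono_ae ?_
  filter_upwards [ae_tsum_weight_ne_top h1] with p hp
  refine lintegral_absDiff_rpow_le_of_moments hZ hp ?_ ?_ hr1 hr2
  · simpa using lintegral_offspringLaw_linear hp (fun _ => 1) i
  · simpa using lintegral_offspringLaw_sq hp (c := fun _ => 1) (by simp) i

lemma measurableSet_apply_eq_one (j : ℕ) : MeasurableSet {b : ℕ → ℕ | b j = 1} :=
  measurable_pi_apply j (measurableSet_singleton 1)

lemma measurable_ite_type (i j : ℕ) (c d : ℝ≥0∞) :
    Measurable fun z : Noise => if z.2 i j = 1 then c else d :=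
  have hm : Measurable fun z : Noise => z.2 i := (measurable_pi_apply i).comp measurable_snd
  Measurable.ite (hm (measurableSet_apply_eq_one j)) measurable_const measurable_const

/-- A vertex of positive type has a child of type `1` with positive probability. -/
lemma lintegral_tsum_type_eq_one_ne_zero (h1 : psi N 1 = 1) {i : ℕ} (hi : i ≠ 0) :
    ∫⁻ z, ∑' j, (if z.2 i j = 1 then 1 else 0 : ℝ≥0∞) ∂noiseLaw N ≠ 0 := by
  intro h
  rw [lintegral_tsum fun j => (measurable_ite_type i j 1 0).aemeasurable, ENNReal.tsum_eq_zero] at h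
  have hw : ∀ j, ∀ᵐ p ∂N, p.weight j = 0 := by
    intro j
    have hm : Measurable fun z : Progeny × (ℕ → ℕ) => (if z.2 j = 1 then 1 else 0 : ℝ≥0∞) :=
      Measurable.ite (measurable_snd (measurableSet_apply_eq_one j)) measurable_const
        measurable_const
    have hj := h j
    rw [lintegral_noiseLaw_type i hm] at hj
    have hm' : ∀ p : Progeny, ∫⁻ b, (if b j = 1 then 1 else 0 : ℝ≥0∞) ∂offspringLaw p i =
        ∑' k : ℕ →₀ ℕ, negMultinomial p.weight i k * (if k j = 1 then 1 else 0 : ℝ≥0∞) := fun p =>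
      lintegral_offspringLaw p i (f := fun b => (if b j = 1 then 1 else 0 : ℝ≥0∞))
        (Measurable.ite (measurableSet_apply_eq_one j) measurable_const measurable_const)
    simp only [hm'] at hj
    rw [lintegral_eq_zero_iff (Measurable.tsum fun k =>
      (measurable_negMultinomial i k).mul_const _)] at hj
    filter_upwards [hj, ae_tsum_weight_ne_top h1] with p hp hpS
    have hz := ENNReal.tsum_eq_zero.1 hp (Finsupp.single j 1)
    obtain ⟨l, rfl⟩ := Nat.exists_eq_succ_of_ne_zero hi
    simp only [Finsupp.single_eq_same, if_true, mul_one] at hz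
    rw [negMultinomial_succ_apply hpS] at hz
    have hs := negMultinomialWeight_add_single p.weight l j 0
    rw [zero_add, hz, mul_zero] at hs
    have hne : negMultinomialWeight p.weight (l + 1) 0 ≠ 0 := by
      simp [negMultinomialWeight, hpS, Finsupp.multinomial_eq]
    have hl : ((l + 1 : ℕ) : ℝ≥0∞) ≠ 0 := by simp
    by_contra hwj
    exact mul_ne_zero (mul_ne_zero hl hwj) hne hs.symm
  have h0 : psi N 1 = 0 := by
    rw [psi_one_eq, lintegral_eq_zero_iff measurable_tsum_weight]
    filter_upwards [ae_all_iff.2 hw] with p hp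
    simp [hp]
  rw [h0] at h1
  exact zero_ne_one h1

end RangeTree

/-! ### An inequality for sums of centred increments -/

/-- The odd power function `sgn(x) |x|^α`. -/
noncomputable def signedRpow (α x : ℝ) : ℝ := if 0 ≤ x then x ^ α else -(-x) ^ α

lemma abs_rpow_sub_rpow_le {α x y : ℝ} (h0 : 0 ≤ α) (h1 : α ≤ 1) (hx : 0 ≤ x) (hy : 0 ≤ y) :
    |x ^ α - y ^ α| ≤ |x - y| ^ α := by
  wlog h : y ≤ x generalizing x y
  · rw [abs_sub_comm, abs_sub_comm x]
    exact this hy hx (le_of_not_ge h)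
  have h2 := Real.rpow_add_le_add_rpow (sub_nonneg.2 h) hy h0 h1
  rw [sub_add_cancel] at h2
  rw [abs_of_nonneg (sub_nonneg.2 (Real.rpow_le_rpow hy h h0)), abs_of_nonneg (sub_nonneg.2 h)]
  linarith

lemma abs_signedRpow_sub_le {α : ℝ} (h0 : 0 ≤ α) (h1 : α ≤ 1) (x y : ℝ) :
    |signedRpow α x - signedRpow α y| ≤ 2 * |x - y| ^ α := by
  have hpos : 0 ≤ |x - y| ^ α := by positivity
  unfold signedRpow
  rcases le_or_gt 0 x with hx | hx <;> rcases le_or_gt 0 y with hy | hy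
  · rw [if_pos hx, if_pos hy]
    linarith [abs_rpow_sub_rpow_le h0 h1 hx hy]
  · rw [if_pos hx, if_neg (not_le.2 hy), sub_neg_eq_add, abs_of_nonneg (by
      have := Real.rpow_nonneg hx α
      have := Real.rpow_nonneg (neg_nonneg.2 hy.le) α
      linarith)]
    have e : |x - y| = x - y := abs_of_nonneg (by linarith)
    have h2 : x ^ α ≤ |x - y| ^ α := Real.rpow_le_rpow hx (by linarith) h0
    have h3 : (-y) ^ α ≤ |x - y| ^ α := Real.rpow_le_rpow (by linarith) (by linarith) h0
    linarith
  · rw [if_pos hy, if_neg (not_le.2 hx), abs_sub_comm, sub_neg_eq_add, abs_of_nonneg (by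
      have := Real.rpow_nonneg hy α
      have := Real.rpow_nonneg (neg_nonneg.2 hx.le) α
      linarith)]
    have e : |x - y| = y - x := by rw [abs_sub_comm]; exact abs_of_nonneg (by linarith)
    have h2 : y ^ α ≤ |x - y| ^ α := Real.rpow_le_rpow hy (by linarith) h0
    have h3 : (-x) ^ α ≤ |x - y| ^ α := Real.rpow_le_rpow (by linarith) (by linarith) h0
    linarith
  · rw [if_neg (not_le.2 hx), if_neg (not_le.2 hy)]
    have h2 := abs_rpow_sub_rpow_le h0 h1 (neg_nonneg.2 hx.le) (neg_nonneg.2 hy.le)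
    have e : |-x - -y| = |x - y| := by rw [abs_sub_comm x y]; congr 1; ring
    rw [e, abs_sub_comm] at h2
    have e2 : -(-x) ^ α - -(-y) ^ α = (-y) ^ α - (-x) ^ α := by ring
    rw [e2]
    linarith

lemma abs_signedRpow (α x : ℝ) : |signedRpow α x| = |x| ^ α := by
  unfold signedRpow
  split_ifs with h
  · rw [abs_of_nonneg (Real.rpow_nonneg h α), abs_of_nonneg h]
  · have h' : x ≤ 0 := (not_le.1 h).le
    rw [abs_neg, abs_of_nonneg (Real.rpow_nonneg (neg_nonneg.2 h') α), abs_of_nonpos h']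

lemma signedRpow_mul_self {α : ℝ} (hα : 0 ≤ α) (x : ℝ) :
    signedRpow α x * x = |x| ^ (1 + α) := by
  unfold signedRpow
  split_ifs with h
  · rw [abs_of_nonneg h, Real.rpow_add' h (by linarith), Real.rpow_one, mul_comm]
  · have h' : 0 ≤ -x := neg_nonneg.2 (not_le.1 h).le
    rw [abs_of_nonpos (not_le.1 h).le, Real.rpow_add' h' (by linarith), Real.rpow_one]
    ring

/-- A first order expansion of `|x|^p`, `1 < p ≤ 2`: the derivative is Hölder continuous with
exponent `p - 1`. -/
lemma abs_add_rpow_le {p : ℝ} (h1 : 1 < p) (h2 : p ≤ 2) (a b : ℝ) :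
    |a + b| ^ p ≤ |a| ^ p + p * signedRpow (p - 1) a * b + 2 * p * |b| ^ p := by
  set c := a + b with hc
  have hα : 0 ≤ p - 1 := by linarith
  have hcc : signedRpow (p - 1) c * c = |c| ^ p := by
    rw [signedRpow_mul_self hα]; congr 1; ring
  -- convexity, in the form of Young's inequality
  have htan : |c| ^ p ≤ |a| ^ p + p * signedRpow (p - 1) c * b := by
    have hy := Real.young_inequality_of_nonneg (abs_nonneg a)
      (Real.rpow_nonneg (abs_nonneg c) (p - 1)) (Real.HolderConjugate.conjExponent h1)
    have e : (|c| ^ (p - 1)) ^ p.conjExponent = |c| ^ p := by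
      rw [← Real.rpow_mul (abs_nonneg c), Real.conjExponent]
      have : p - 1 ≠ 0 := by linarith
      congr 1
      field_simp
    rw [e, Real.conjExponent] at hy
    have hle : signedRpow (p - 1) c * a ≤ |a| * |c| ^ (p - 1) := by
      refine (le_abs_self _).trans ?_
      rw [abs_mul, abs_signedRpow, mul_comm]
    have hp : 0 < p := by linarith
    have hmul : p * (signedRpow (p - 1) c * a) ≤ |a| ^ p + (p - 1) * |c| ^ p := by
      calc p * (signedRpow (p - 1) c * a) ≤ p * (|a| ^ p / p + |c| ^ p / (p / (p - 1))) := by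
            gcongr; exact hle.trans hy
        _ = _ := by
            have : p - 1 ≠ 0 := by linarith
            field_simp
    have hb : b = c - a := by rw [hc]; ring
    have : p * signedRpow (p - 1) c * b = p * |c| ^ p - p * (signedRpow (p - 1) c * a) := by
      rw [← hcc, hb]; ring
    linarith
  have hhol := abs_signedRpow_sub_le hα (by linarith) c a
  have hca : c - a = b := by rw [hc]; ring
  rw [hca] at hhol
  have hb : |b| ^ p = |b| ^ (p - 1) * |b| := by
    conv_lhs => rw [show p = (p - 1) + 1 by ring]
    rw [Real.rpow_add' (abs_nonneg b) (by linarith), Real.rpow_one]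
  have h3 : (signedRpow (p - 1) c - signedRpow (p - 1) a) * b ≤ 2 * |b| ^ p := by
    refine (le_abs_self _).trans ?_
    rw [abs_mul, hb, ← mul_assoc]
    gcongr
  nlinarith

lemma lintegral_abs_add_rpow_le {Ω : Type*} [MeasurableSpace Ω] {ν : Measure Ω}
    [IsProbabilityMeasure ν] {p : ℝ} (h1 : 1 < p) (h2 : p ≤ 2) {y : Ω → ℝ} (hm : Measurable y)
    (hy : Integrable y ν) (h0 : ∫ ω, y ω ∂ν = 0) (a : ℝ) :
    ∫⁻ ω, ENNReal.ofReal (|a + y ω| ^ p) ∂ν ≤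
      ENNReal.ofReal (|a| ^ p) + ENNReal.ofReal (2 * p) * ∫⁻ ω, ENNReal.ofReal (|y ω| ^ p) ∂ν := by
  have hmp : Measurable fun ω => |y ω| ^ p := (measurable_norm.comp hm).pow_const p
  have hp : 0 < 2 * p := by linarith
  by_cases htop : ∫⁻ ω, ENNReal.ofReal (|y ω| ^ p) ∂ν = ⊤
  · rw [htop, ENNReal.mul_top (by simpa using hp)]
    simp
  have hip : Integrable (fun ω => |y ω| ^ p) ν := by
    refine ⟨hmp.aestronglyMeasurable, ?_⟩
    rw [hasFiniteIntegral_iff_ofReal (ae_of_all _ fun ω => by positivity)]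
    exact lt_top_iff_ne_top.2 htop
  set g : Ω → ℝ := fun ω => |a| ^ p + p * signedRpow (p - 1) a * y ω + 2 * p * |y ω| ^ p with hg
  have hle : ∀ ω, |a + y ω| ^ p ≤ g ω := fun ω => abs_add_rpow_le h1 h2 a (y ω)
  have hig : Integrable g ν :=
    ((integrable_const _).add (hy.const_mul _)).add (hip.const_mul _)
  have hval : ∫ ω, g ω ∂ν = |a| ^ p + 2 * p * ∫ ω, |y ω| ^ p ∂ν := by
    have hi1 : Integrable (fun ω => |a| ^ p + p * signedRpow (p - 1) a * y ω) ν :=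
      (integrable_const _).add (hy.const_mul _)
    simp only [hg]
    rw [integral_add hi1 (hip.const_mul _),
      integral_add (integrable_const _) (hy.const_mul _), integral_const_mul, integral_const_mul, h0]
    simp
  calc ∫⁻ ω, ENNReal.ofReal (|a + y ω| ^ p) ∂ν ≤ ∫⁻ ω, ENNReal.ofReal (g ω) ∂ν :=
        lintegral_mono fun ω => ENNReal.ofReal_le_ofReal (hle ω)
    _ = ENNReal.ofReal (∫ ω, g ω ∂ν) := by
        rw [ofReal_integral_eq_lintegral_ofReal hig
          (ae_of_all _ fun ω => le_trans (by positivity) (hle ω))]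
    _ = _ := by
        rw [hval, ENNReal.ofReal_add (by positivity)
          (mul_nonneg hp.le (integral_nonneg fun ω => by positivity)), ENNReal.ofReal_mul hp.le,
          ofReal_integral_eq_lintegral_ofReal hip (ae_of_all _ fun ω => by positivity)]

/-! ### The tree of killed types -/

namespace RangeTree

/-- The state of a vertex: its weight and its type, the latter replaced by `0` from the first vertex
of type `1` on. -/
abbrev State : Type := ℝ≥0∞ × ℕ

/-- The state of the `j`-th child of a vertex of state `s`. -/
noncomputable def child (s : State) (z : Noise) (j : ℕ) : State :=
  (s.1 * z.1.weight j, if z.2 s.2 j = 1 then 0 else z.2 s.2 j)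

/-- The states of all vertices, when the root has state `s₀`. -/
noncomputable def stateAt (s₀ : State) (η : Vertex → Noise) : Vertex → State
  | [] => s₀
  | j :: u => child (stateAt s₀ η u) (η u) j

lemma measurable_typeOf (j : ℕ) : Measurable fun x : State × Noise => x.2.2 x.1.2 j := by
  have h : Measurable fun x : (ℕ → ℕ → ℕ) × ℕ => x.1 x.2 j :=
    measurable_from_prod_countable_left fun y =>
      (measurable_pi_apply j).comp (measurable_pi_apply y)
  exact h.comp ((measurable_snd.comp measurable_snd).prodMk (measurable_snd.comp measurable_fst))

lemma measurable_weightOf (j : ℕ) : Measurable fun x : State × Noise => x.2.1.weight j :=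
  (measurable_weight j).comp (measurable_fst.comp measurable_snd)

lemma measurable_child (j : ℕ) : Measurable fun x : State × Noise => child x.1 x.2 j := by
  refine Measurable.prodMk ((measurable_fst.comp measurable_fst).mul (measurable_weightOf j)) ?_
  exact Measurable.ite (measurable_typeOf j (measurableSet_singleton 1)) measurable_const
    (measurable_typeOf j)

lemma measurable_stateAt (s₀ : State) (u : Vertex) :
    Measurable fun η : Vertex → Noise => stateAt s₀ η u := by
  induction u with
  | nil => exact measurable_const
  | cons j u ih => exact (measurable_child j).comp (ih.prodMk (measurable_pi_apply u))

lemma stateAt_fst_ne_top {s₀ : State} (h : s₀.1 ≠ ⊤) (η : Vertex → Noise) (u : Vertex) :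
    (stateAt s₀ η u).1 ≠ ⊤ := by
  induction u with
  | nil => exact h
  | cons j u ih => exact ENNReal.mul_ne_top ih (weight_ne_top _ j)

/-- The state of a vertex depends on the randomness of its strict ancestors only. -/
lemma stateAt_update (s₀ : State) (η : Vertex → Noise) {u v : Vertex} (z : Noise)
    (h : v.length ≤ u.length) : stateAt s₀ (Function.update η u z) v = stateAt s₀ η v := by
  induction v with
  | nil => rfl
  | cons j v ih =>
    rw [List.length_cons] at h
    have hne : v ≠ u := by rintro rfl; omega
    simp only [stateAt]
    rw [ih (by omega), Function.update_of_ne hne]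

lemma lintegral_stateAt_noise (N : Measure Progeny) [IsProbabilityMeasure N] (s₀ : State)
    (u : Vertex) {g : State × Noise → ℝ≥0∞} (hg : Measurable g) :
    ∫⁻ η, g (stateAt s₀ η u, η u) ∂treeLaw N =
      ∫⁻ η, ∫⁻ z, g (stateAt s₀ η u, z) ∂noiseLaw N ∂treeLaw N := by
  have hm : Measurable fun η : Vertex → Noise => g (stateAt s₀ η u, η u) :=
    hg.comp ((measurable_stateAt s₀ u).prodMk (measurable_pi_apply u))
  unfold treeLaw
  rw [lintegral_infinitePi_update (noiseLaw N) u hm]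
  refine lintegral_congr fun η => lintegral_congr fun z => ?_
  rw [stateAt_update s₀ η z le_rfl, Function.update_self]

/-- The sum over the vertices of generation `k`. -/
noncomputable def genSum (k : ℕ) (f : Vertex → ℝ≥0∞) : ℝ≥0∞ :=
  ∑' u : Vertex, if u.length = k then f u else 0

lemma genSum_zero (f : Vertex → ℝ≥0∞) : genSum 0 f = f [] := by
  unfold genSum
  rw [tsum_eq_single []]
  · simp
  · intro u hu
    simp [hu]

lemma genSum_succ (k : ℕ) (f : Vertex → ℝ≥0∞) :
    genSum (k + 1) f = genSum k fun u => ∑' j, f (j :: u) := by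
  unfold genSum
  have hinj : Function.Injective fun x : Vertex × ℕ => x.2 :: x.1 := by
    rintro ⟨u, i⟩ ⟨v, j⟩ h
    simp only [List.cons.injEq] at h
    exact Prod.ext h.2 h.1
  rw [← hinj.tsum_eq, ENNReal.tsum_prod (f := fun (u : Vertex) (j : ℕ) =>
    if (j :: u).length = k + 1 then f (j :: u) else 0)]
  · refine tsum_congr fun u => ?_
    by_cases h : u.length = k <;> simp [h]
  · intro u hu
    cases u with
    | nil => simp at hu
    | cons j u => exact ⟨(u, j), rfl⟩

lemma genSum_mono {k : ℕ} {f g : Vertex → ℝ≥0∞} (h : ∀ u, f u ≤ g u) : genSum k f ≤ genSum k g :=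
  ENNReal.tsum_le_tsum fun u => by split_ifs <;> simp [h u]

lemma genSum_add (k : ℕ) (f g : Vertex → ℝ≥0∞) :
    genSum k (fun u => f u + g u) = genSum k f + genSum k g := by
  unfold genSum
  rw [← ENNReal.tsum_add]
  exact tsum_congr fun u => by split_ifs <;> simp

lemma genSum_const_mul (k : ℕ) (c : ℝ≥0∞) (f : Vertex → ℝ≥0∞) :
    genSum k (fun u => c * f u) = c * genSum k f := by
  unfold genSum
  rw [← ENNReal.tsum_mul_left]
  exact tsum_congr fun u => by split_ifs <;> simp

lemma measurable_genSum (k : ℕ) {f : (Vertex → Noise) → Vertex → ℝ≥0∞}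
    (hf : ∀ u, Measurable fun η => f η u) : Measurable fun η => genSum k (f η) :=
  Measurable.tsum fun u => by
    by_cases h : u.length = k
    · simpa [h] using hf u
    · simp [h]

lemma lintegral_genSum {ν : Measure (Vertex → Noise)} (k : ℕ)
    {f : (Vertex → Noise) → Vertex → ℝ≥0∞} (hf : ∀ u, Measurable fun η => f η u) :
    ∫⁻ η, genSum k (f η) ∂ν = genSum k fun u => ∫⁻ η, f η u ∂ν := by
  unfold genSum
  rw [lintegral_tsum]
  · exact tsum_congr fun u => by split_ifs <;> simp
  · intro u
    by_cases h : u.length = k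
    · simpa [h] using (hf u).aemeasurable
    · simp [h]

/-- The expected sum of a function of the state over a generation. -/
noncomputable def meanGen (N : Measure Progeny) [IsProbabilityMeasure N] (s₀ : State) (k : ℕ)
    (f : State → ℝ≥0∞) : ℝ≥0∞ :=
  ∫⁻ η, genSum k (fun u => f (stateAt s₀ η u)) ∂treeLaw N

section

variable {N : Measure Progeny} [IsProbabilityMeasure N] {s₀ : State}

lemma meanGen_eq_genSum (k : ℕ) {f : State → ℝ≥0∞} (hf : Measurable f) :
    meanGen N s₀ k f = genSum k fun u => ∫⁻ η, f (stateAt s₀ η u) ∂treeLaw N :=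
  lintegral_genSum k fun u => hf.comp (measurable_stateAt s₀ u)

lemma meanGen_zero (f : State → ℝ≥0∞) : meanGen N s₀ 0 f = f s₀ := by
  simp [meanGen, genSum_zero, stateAt]

lemma meanGen_mono (hs : s₀.1 ≠ ⊤) (k : ℕ) {f g : State → ℝ≥0∞} (h : ∀ s, s.1 ≠ ⊤ → f s ≤ g s) :
    meanGen N s₀ k f ≤ meanGen N s₀ k g :=
  lintegral_mono fun η => genSum_mono fun u => h _ (stateAt_fst_ne_top hs η u)

lemma meanGen_add (k : ℕ) {f : State → ℝ≥0∞} (hf : Measurable f) (g : State → ℝ≥0∞) :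
    meanGen N s₀ k (fun s => f s + g s) = meanGen N s₀ k f + meanGen N s₀ k g := by
  unfold meanGen
  simp_rw [genSum_add]
  exact lintegral_add_left (measurable_genSum k fun u => hf.comp (measurable_stateAt s₀ u)) _

lemma meanGen_const_mul (k : ℕ) (c : ℝ≥0∞) {f : State → ℝ≥0∞} (hf : Measurable f) :
    meanGen N s₀ k (fun s => c * f s) = c * meanGen N s₀ k f := by
  unfold meanGen
  simp_rw [genSum_const_mul]
  exact lintegral_const_mul _ (measurable_genSum k fun u => hf.comp (measurable_stateAt s₀ u))

/-- The many-vertices form of the branching property: the noise of each vertex of generation `k` may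
be averaged given its state. -/
lemma lintegral_genSum_noise (k : ℕ) {g : State × Noise → ℝ≥0∞} (hg : Measurable g) :
    ∫⁻ η, genSum k (fun u => g (stateAt s₀ η u, η u)) ∂treeLaw N =
      meanGen N s₀ k fun s => ∫⁻ z, g (s, z) ∂noiseLaw N := by
  have hm : ∀ u, Measurable fun η : Vertex → Noise => g (stateAt s₀ η u, η u) := fun u =>
    hg.comp ((measurable_stateAt s₀ u).prodMk (measurable_pi_apply u))
  rw [meanGen_eq_genSum k hg.lintegral_prod_right', lintegral_genSum k hm]
  congr 1
  funext u
  exact lintegral_stateAt_noise N s₀ u hg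

lemma meanGen_succ (k : ℕ) {f : State → ℝ≥0∞} (hf : Measurable f) :
    meanGen N s₀ (k + 1) f =
      meanGen N s₀ k fun s => ∫⁻ z, ∑' j, f (child s z j) ∂noiseLaw N := by
  have hg : Measurable fun x : State × Noise => ∑' j, f (child x.1 x.2 j) :=
    Measurable.tsum fun j => hf.comp (measurable_child j)
  rw [← lintegral_genSum_noise k hg]
  unfold meanGen
  simp_rw [genSum_succ]
  rfl

end

/-! ### The martingale difference between killed types and weights -/


/-- The sum of the types of the children of a vertex of state `s`, counting also those of type `1`. -/
noncomputable def offspringType (s : State) (z : Noise) : ℝ≥0∞ := ∑' j, (z.2 s.2 j : ℝ≥0∞)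

/-- The contribution of a vertex of state `s` to the increment of the difference of the martingale of
types and that of weights. -/
noncomputable def innovation (s : State) (z : Noise) : ℝ :=
  ((offspringType s z).toReal - s.2) - s.1.toReal * ((∑' j, z.1.weight j).toReal - 1)

lemma measurable_offspringType : Measurable fun x : State × Noise => offspringType x.1 x.2 :=
  Measurable.tsum fun j =>
    (measurable_from_top (f := fun n : ℕ => (n : ℝ≥0∞))).comp (measurable_typeOf j)

lemma measurable_state_type : Measurable fun s : State => (s.2 : ℝ≥0∞) :=
  (measurable_from_top (f := fun n : ℕ => (n : ℝ≥0∞))).comp measurable_snd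

lemma measurable_innovation : Measurable fun x : State × Noise => innovation x.1 x.2 := by
  have h1 : Measurable fun x : State × Noise => ((x.1.2 : ℕ) : ℝ) :=
    (measurable_from_top (f := fun n : ℕ => (n : ℝ))).comp (measurable_snd.comp measurable_fst)
  have h2 : Measurable fun x : State × Noise => x.1.1.toReal :=
    (measurable_fst.comp measurable_fst).ennreal_toReal
  have h3 : Measurable fun x : State × Noise => (∑' j, x.2.1.weight j).toReal :=
    (Measurable.tsum fun j => measurable_weightOf j).ennreal_toReal
  exact (measurable_offspringType.ennreal_toReal.sub h1).sub (h2.mul (h3.sub measurable_const))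

lemma measurable_innovation_right (s : State) : Measurable fun z => innovation s z := by
  have h : Measurable ((fun x : State × Noise => innovation x.1 x.2) ∘ Prod.mk s) :=
    measurable_innovation.comp measurable_prodMk_left
  exact h

lemma measurable_tsum_weight_fst : Measurable fun z : Noise => ∑' j, z.1.weight j :=
  measurable_tsum_weight.comp measurable_fst

section

variable {N : Measure Progeny} [IsProbabilityMeasure N] {s₀ : State}

lemma lintegral_offspringType (h1 : psi N 1 = 1) (s : State) :
    ∫⁻ z, offspringType s z ∂noiseLaw N = s.2 := lintegral_tsum_type h1 s.2

lemma lintegral_noise_tsum_weight (h1 : psi N 1 = 1) :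
    ∫⁻ z, ∑' j, z.1.weight j ∂noiseLaw N = 1 := by
  rw [lintegral_noiseLaw_fst measurable_tsum_weight, ← psi_one_eq, h1]

lemma integrable_innovation_and_integral_eq_zero (h1 : psi N 1 = 1) (s : State) :
    Integrable (fun z => innovation s z) (noiseLaw N) ∧
      ∫ z, innovation s z ∂noiseLaw N = 0 := by
  have hZm : Measurable fun z => offspringType s z :=
    measurable_offspringType.comp measurable_prodMk_left
  have hZf : ∫⁻ z, offspringType s z ∂noiseLaw N ≠ ⊤ := by
    rw [lintegral_offspringType h1]; simp
  have hSf : ∫⁻ z, ∑' j, z.1.weight j ∂noiseLaw N ≠ ⊤ := by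
    rw [lintegral_noise_tsum_weight h1]; simp
  have hZ := integrable_toReal_of_lintegral_ne_top hZm.aemeasurable hZf
  have hS := integrable_toReal_of_lintegral_ne_top measurable_tsum_weight_fst.aemeasurable hSf
  have hZi : ∫ z, (offspringType s z).toReal ∂noiseLaw N = s.2 := by
    rw [integral_toReal hZm.aemeasurable (ae_lt_top hZm hZf), lintegral_offspringType h1]; simp
  have hSi : ∫ z : Noise, (∑' j, z.1.weight j).toReal ∂noiseLaw N = 1 := by
    rw [integral_toReal measurable_tsum_weight_fst.aemeasurable
      (ae_lt_top measurable_tsum_weight_fst hSf), lintegral_noise_tsum_weight h1]; simp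
  have hi1 : Integrable (fun z => (offspringType s z).toReal - (s.2 : ℝ)) (noiseLaw N) :=
    hZ.sub (integrable_const _)
  have hi2 : Integrable (fun z : Noise => s.1.toReal * ((∑' j, z.1.weight j).toReal - 1))
      (noiseLaw N) := (hS.sub (integrable_const _)).const_mul _
  refine ⟨hi1.sub hi2, ?_⟩
  unfold innovation
  rw [integral_sub hi1 hi2, integral_sub hZ (integrable_const _), integral_const_mul,
    integral_sub hS (integrable_const _), hZi, hSi]
  simp

/-- The `p`-th moment of the innovation of a vertex of state `s`. -/
noncomputable def innovationMoment (N : Measure Progeny) [IsProbabilityMeasure N] (p : ℝ)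
    (s : State) : ℝ≥0∞ := ∫⁻ z, ENNReal.ofReal (|innovation s z| ^ p) ∂noiseLaw N

lemma measurable_ofReal_abs_rpow {B : Type*} [MeasurableSpace B] {f : B → ℝ} (hf : Measurable f)
    (p : ℝ) : Measurable fun x => ENNReal.ofReal (|f x| ^ p) :=
  ((measurable_norm.comp hf).pow_const p).ennreal_ofReal

lemma measurable_innovationMoment (p : ℝ) : Measurable (innovationMoment N p) :=
  (measurable_ofReal_abs_rpow measurable_innovation p).lintegral_prod_right'

lemma measurable_innovation_stateAt (s₀ : State) (u : Vertex) :
    Measurable fun η : Vertex → Noise => innovation (stateAt s₀ η u) (η u) := by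
  have h : Measurable ((fun x : State × Noise => innovation x.1 x.2) ∘
      fun η : Vertex → Noise => (stateAt s₀ η u, η u)) :=
    measurable_innovation.comp ((measurable_stateAt s₀ u).prodMk (measurable_pi_apply u))
  exact h

/-- An inequality of von Bahr-Esseen type: the innovation of a vertex is centred given the noises of
all the vertices that are not longer, so that the vertices of a finite set can be removed one by one,
the longest ones first. -/
lemma lintegral_abs_sum_innovation_rpow_le (h1 : psi N 1 = 1) {p : ℝ} (hp1 : 1 < p) (hp2 : p ≤ 2)
    (F : Finset Vertex) :
    ∫⁻ η, ENNReal.ofReal (|∑ u ∈ F, innovation (stateAt s₀ η u) (η u)| ^ p) ∂treeLaw N ≤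
      ENNReal.ofReal (2 * p) *
        ∑ u ∈ F, ∫⁻ η, innovationMoment N p (stateAt s₀ η u) ∂treeLaw N := by
  classical
  induction F using Finset.induction_on_max_value (fun u : Vertex => u.length) with
  | empty => simp [Real.zero_rpow (by linarith : p ≠ 0)]
  | insert a s ha hmax ih =>
    have hGm : Measurable fun η : Vertex → Noise =>
        ∑ u ∈ s, innovation (stateAt s₀ η u) (η u) :=
      Finset.measurable_sum _ fun u _ => measurable_innovation_stateAt s₀ u
    set G : (Vertex → Noise) → ℝ := fun η => ∑ u ∈ s, innovation (stateAt s₀ η u) (η u) with hG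
    have hGup : ∀ η z, G (Function.update η a z) = G η := by
      intro η z
      refine Finset.sum_congr rfl fun u hu => ?_
      have hne : u ≠ a := fun h => ha (h ▸ hu)
      rw [stateAt_update s₀ η z (hmax u hu), Function.update_of_ne hne]
    have hm := measurable_ofReal_abs_rpow (hGm.add (measurable_innovation_stateAt s₀ a)) p
    have hm' := (measurable_innovationMoment (N := N) p).comp (measurable_stateAt s₀ a)
    calc ∫⁻ η, ENNReal.ofReal (|∑ u ∈ insert a s, innovation (stateAt s₀ η u) (η u)| ^ p) ∂treeLaw N
        = ∫⁻ η, ENNReal.ofReal (|G η + innovation (stateAt s₀ η a) (η a)| ^ p) ∂treeLaw N := by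
          simp only [Finset.sum_insert ha, hG, add_comm]
      _ = ∫⁻ η, ∫⁻ z, ENNReal.ofReal (|G η + innovation (stateAt s₀ η a) z| ^ p)
            ∂noiseLaw N ∂treeLaw N := by
          unfold treeLaw
          refine (lintegral_infinitePi_update (noiseLaw N) a hm).trans ?_
          refine lintegral_congr fun η => lintegral_congr fun z => ?_
          simp only [Pi.add_apply]
          rw [hGup, stateAt_update s₀ η z le_rfl, Function.update_self]
      _ ≤ ∫⁻ η, (ENNReal.ofReal (|G η| ^ p) +
            ENNReal.ofReal (2 * p) * innovationMoment N p (stateAt s₀ η a)) ∂treeLaw N := by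
          refine lintegral_mono fun η => ?_
          obtain ⟨hi, h0⟩ := integrable_innovation_and_integral_eq_zero h1 (stateAt s₀ η a)
          exact lintegral_abs_add_rpow_le hp1 hp2 (measurable_innovation_right _) hi h0 (G η)
      _ = ∫⁻ η, ENNReal.ofReal (|G η| ^ p) ∂treeLaw N + ENNReal.ofReal (2 * p) *
            ∫⁻ η, innovationMoment N p (stateAt s₀ η a) ∂treeLaw N := by
          rw [lintegral_add_left (measurable_ofReal_abs_rpow hGm p)]
          congr 1
          exact lintegral_const_mul _ hm'
      _ ≤ _ := by
          rw [Finset.sum_insert ha, mul_add, add_comm]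
          gcongr

lemma lintegral_abs_rpow_le_of_hasSum (h1 : psi N 1 = 1) {p : ℝ} (hp1 : 1 < p) (hp2 : p ≤ 2)
    (T : Vertex → Prop) [DecidablePred T] {D : (Vertex → Noise) → ℝ}
    (hD : ∀ᵐ η ∂treeLaw N,
      HasSum (fun u => if T u then innovation (stateAt s₀ η u) (η u) else 0) (D η)) :
    ∫⁻ η, ENNReal.ofReal (|D η| ^ p) ∂treeLaw N ≤ ENNReal.ofReal (2 * p) *
      ∑' u, if T u then ∫⁻ η, innovationMoment N p (stateAt s₀ η u) ∂treeLaw N else 0 := by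
  obtain ⟨F, hF⟩ := Filter.exists_seq_tendsto (atTop : Filter (Finset Vertex))
  set P : ℕ → (Vertex → Noise) → ℝ := fun n η =>
    ∑ u ∈ (F n).filter T, innovation (stateAt s₀ η u) (η u) with hP
  have hPm : ∀ n, Measurable (P n) := fun n =>
    Finset.measurable_sum _ fun u _ => measurable_innovation_stateAt s₀ u
  have hlim : ∀ᵐ η ∂treeLaw N, ENNReal.ofReal (|D η| ^ p) =
      liminf (fun n => ENNReal.ofReal (|P n η| ^ p)) atTop := by
    filter_upwards [hD] with η hη
    have ht : Tendsto (fun n => P n η) atTop (𝓝 (D η)) := by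
      refine (hη.comp hF).congr fun n => ?_
      simp only [hP, Function.comp, Finset.sum_filter]
    have hc : Continuous fun x : ℝ => ENNReal.ofReal (|x| ^ p) :=
      ENNReal.continuous_ofReal.comp ((Real.continuous_rpow_const (by linarith)).comp continuous_abs)
    exact ((hc.tendsto _).comp ht).liminf_eq.symm
  rw [lintegral_congr_ae hlim]
  refine (lintegral_liminf_le fun n => measurable_ofReal_abs_rpow (hPm n) p).trans ?_
  refine liminf_le_of_le (by isBoundedDefault) fun b hb => ?_
  obtain ⟨n, hn⟩ := hb.exists
  refine hn.trans ((lintegral_abs_sum_innovation_rpow_le h1 hp1 hp2 _).trans ?_)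
  rw [Finset.sum_filter]
  gcongr
  exact ENNReal.sum_le_tsum _

/-! ### Generation sums -/

/-- The sum of the killed types over generation `k`. -/
noncomputable def totalType (s₀ : State) (k : ℕ) (η : Vertex → Noise) : ℝ≥0∞ :=
  genSum k fun u => ((stateAt s₀ η u).2 : ℝ≥0∞)

/-- The sum of the weights over generation `k`. -/
noncomputable def totalWeight (s₀ : State) (k : ℕ) (η : Vertex → Noise) : ℝ≥0∞ :=
  genSum k fun u => (stateAt s₀ η u).1

/-- The number of vertices killed at generation `k + 1`. -/
noncomputable def killed (s₀ : State) (k : ℕ) (η : Vertex → Noise) : ℝ≥0∞ :=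
  genSum k fun u => ∑' j, if (η u).2 (stateAt s₀ η u).2 j = 1 then 1 else 0

lemma measurable_totalType (s₀ : State) (k : ℕ) : Measurable (totalType s₀ k) :=
  measurable_genSum k fun u => measurable_state_type.comp (measurable_stateAt s₀ u)

lemma measurable_totalWeight (s₀ : State) (k : ℕ) : Measurable (totalWeight s₀ k) :=
  measurable_genSum k fun u => measurable_fst.comp (measurable_stateAt s₀ u)

lemma measurable_killed (s₀ : State) (k : ℕ) : Measurable (killed s₀ k) :=
  measurable_genSum k fun u => Measurable.tsum fun j => by
    have hm : Measurable fun η : Vertex → Noise => (η u).2 (stateAt s₀ η u).2 j :=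
      (measurable_typeOf j).comp ((measurable_stateAt s₀ u).prodMk (measurable_pi_apply u))
    exact Measurable.ite (hm (measurableSet_singleton 1)) measurable_const measurable_const

lemma totalWeight_succ (s₀ : State) (k : ℕ) (η : Vertex → Noise) :
    totalWeight s₀ (k + 1) η =
      genSum k fun u => (stateAt s₀ η u).1 * ∑' j, (η u).1.weight j := by
  unfold totalWeight
  rw [genSum_succ]
  simp only [stateAt, child, ENNReal.tsum_mul_left]

lemma totalType_succ_add_killed (s₀ : State) (k : ℕ) (η : Vertex → Noise) :
    totalType s₀ (k + 1) η + killed s₀ k η =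
      genSum k fun u => offspringType (stateAt s₀ η u) (η u) := by
  unfold totalType killed
  rw [genSum_succ, ← genSum_add]
  congr 1
  funext u
  rw [offspringType, ← ENNReal.tsum_add]
  refine tsum_congr fun j => ?_
  simp only [stateAt, child]
  split_ifs with h <;> simp [h]

lemma lintegral_totalWeight (h1 : psi N 1 = 1) (k : ℕ) :
    ∫⁻ η, totalWeight s₀ k η ∂treeLaw N = s₀.1 := by
  induction k with
  | zero => simp [totalWeight, genSum_zero, stateAt]
  | succ k ih =>
    have hg : Measurable fun x : State × Noise => x.1.1 * ∑' j, x.2.1.weight j :=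
      (measurable_fst.comp measurable_fst).mul (Measurable.tsum fun j => measurable_weightOf j)
    simp_rw [totalWeight_succ]
    rw [lintegral_genSum_noise k hg, ← ih]
    unfold meanGen totalWeight
    congr 1
    funext η
    congr 1
    funext u
    dsimp only
    rw [lintegral_const_mul _ measurable_tsum_weight_fst, lintegral_noise_tsum_weight h1, mul_one]

lemma lintegral_totalType_succ_add_killed (h1 : psi N 1 = 1) (k : ℕ) :
    ∫⁻ η, (totalType s₀ (k + 1) η + killed s₀ k η) ∂treeLaw N =
      ∫⁻ η, totalType s₀ k η ∂treeLaw N := by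
  simp_rw [totalType_succ_add_killed]
  rw [lintegral_genSum_noise k measurable_offspringType]
  unfold meanGen totalType
  congr 1
  funext η
  congr 1
  funext u
  exact lintegral_offspringType h1 _

lemma lintegral_totalType_le (h1 : psi N 1 = 1) (k : ℕ) :
    ∫⁻ η, totalType s₀ k η ∂treeLaw N ≤ s₀.2 := by
  induction k with
  | zero => simp [totalType, genSum_zero, stateAt]
  | succ k ih =>
    refine le_trans ?_ ((lintegral_totalType_succ_add_killed h1 k).le.trans ih)
    exact lintegral_mono fun η => le_self_add

lemma ae_finite (h1 : psi N 1 = 1) (hs : s₀.1 ≠ ⊤) :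
    ∀ᵐ η ∂treeLaw N, ∀ k, totalWeight s₀ k η ≠ ⊤ ∧ totalType s₀ k η ≠ ⊤ ∧ killed s₀ k η ≠ ⊤ := by
  refine ae_all_iff.2 fun k => ?_
  have hX : ∀ k, ∫⁻ η, totalType s₀ k η ∂treeLaw N ≠ ⊤ := fun k =>
    ne_top_of_le_ne_top (by simp) (lintegral_totalType_le h1 k)
  have hW : ∫⁻ η, totalWeight s₀ k η ∂treeLaw N ≠ ⊤ := by rw [lintegral_totalWeight h1]; exact hs
  have hR : ∫⁻ η, (totalType s₀ (k + 1) η + killed s₀ k η) ∂treeLaw N ≠ ⊤ := by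
    rw [lintegral_totalType_succ_add_killed h1]; exact hX k
  have hRm : Measurable fun η => totalType s₀ (k + 1) η + killed s₀ k η :=
    (measurable_totalType s₀ (k + 1)).add (measurable_killed s₀ k)
  filter_upwards [ae_lt_top (measurable_totalWeight s₀ k) hW,
    ae_lt_top (measurable_totalType s₀ k) (hX k), ae_lt_top hRm hR] with η h2 h3 h4
  exact ⟨h2.ne, h3.ne, (ENNReal.add_ne_top.1 h4.ne).2⟩

lemma hasSum_toReal_genSum {k : ℕ} {f : Vertex → ℝ≥0∞} (h : genSum k f ≠ ⊤) :
    HasSum (fun u : Vertex => if u.length = k then (f u).toReal else 0) (genSum k f).toReal := by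
  have hf : ∀ u : Vertex, (if u.length = k then f u else 0) ≠ ⊤ := ENNReal.ne_top_of_tsum_ne_top h
  have hs := ENNReal.hasSum_toReal h
  rw [← ENNReal.tsum_toReal_eq hf] at hs
  refine hs.congr_fun fun u => ?_
  split_ifs <;> simp

/-- The number of vertices killed up to generation `m`, plus the sum of the killed types over
generation `m`: this is the martingale of types. -/
noncomputable def typeMartingale (s₀ : State) (m : ℕ) (η : Vertex → Noise) : ℝ≥0∞ :=
  ∑ k ∈ Finset.range m, killed s₀ k η + totalType s₀ m η

lemma hasSum_innovation_gen {η : Vertex → Noise}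
    (hη : ∀ k, totalWeight s₀ k η ≠ ⊤ ∧ totalType s₀ k η ≠ ⊤ ∧ killed s₀ k η ≠ ⊤) (k : ℕ) :
    HasSum (fun u : Vertex => if u.length = k then innovation (stateAt s₀ η u) (η u) else 0)
      (((typeMartingale s₀ (k + 1) η).toReal - (totalWeight s₀ (k + 1) η).toReal) -
        ((typeMartingale s₀ k η).toReal - (totalWeight s₀ k η).toReal)) := by
  have hZ : (genSum k fun u => offspringType (stateAt s₀ η u) (η u)) ≠ ⊤ := by
    rw [← totalType_succ_add_killed]
    exact ENNReal.add_ne_top.2 ⟨(hη (k + 1)).2.1, (hη k).2.2⟩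
  have hS : (genSum k fun u => (stateAt s₀ η u).1 * ∑' j, (η u).1.weight j) ≠ ⊤ := by
    rw [← totalWeight_succ]
    exact (hη (k + 1)).1
  have hsum := ((hasSum_toReal_genSum hZ).sub (hasSum_toReal_genSum (hη k).2.1)).sub
    ((hasSum_toReal_genSum hS).sub (hasSum_toReal_genSum (hη k).1))
  have hR : (∑ l ∈ Finset.range k, killed s₀ l η) ≠ ⊤ :=
    ENNReal.sum_ne_top.2 fun l _ => (hη l).2.2
  have hR' : (∑ l ∈ Finset.range (k + 1), killed s₀ l η) ≠ ⊤ :=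
    ENNReal.sum_ne_top.2 fun l _ => (hη l).2.2
  have hval : ((typeMartingale s₀ (k + 1) η).toReal - (totalWeight s₀ (k + 1) η).toReal) -
        ((typeMartingale s₀ k η).toReal - (totalWeight s₀ k η).toReal) =
      (genSum k fun u => offspringType (stateAt s₀ η u) (η u)).toReal -
        (genSum k fun u => ((stateAt s₀ η u).2 : ℝ≥0∞)).toReal -
        ((genSum k fun u => (stateAt s₀ η u).1 * ∑' j, (η u).1.weight j).toReal -
          (genSum k fun u => (stateAt s₀ η u).1).toReal) := by
    rw [← totalType_succ_add_killed, ← totalWeight_succ, ENNReal.toReal_add (hη (k + 1)).2.1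
      (hη k).2.2]
    unfold typeMartingale
    rw [ENNReal.toReal_add hR' (hη (k + 1)).2.1, ENNReal.toReal_add hR (hη k).2.1,
      Finset.sum_range_succ, ENNReal.toReal_add hR (hη k).2.2]
    change _ = _ - (totalType s₀ k η).toReal - (_ - (totalWeight s₀ k η).toReal)
    ring
  rw [hval]
  refine hsum.congr_fun fun u => ?_
  split_ifs
  · simp only [innovation, ENNReal.toReal_mul, ENNReal.toReal_natCast]
    ring
  · simp

lemma tsum_ite_eq_meanGen (p : ℝ) (k : ℕ) :
    (∑' u : Vertex, if u.length = k then
      ∫⁻ η, innovationMoment N p (stateAt s₀ η u) ∂treeLaw N else 0) =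
      meanGen N s₀ k (innovationMoment N p) :=
  (meanGen_eq_genSum k (measurable_innovationMoment p)).symm

/-- Moment bound for one increment of the difference of the two martingales. -/
lemma lintegral_abs_increment_rpow_le (h1 : psi N 1 = 1) (hs : s₀.1 ≠ ⊤) {p : ℝ} (hp1 : 1 < p)
    (hp2 : p ≤ 2) (k : ℕ) :
    ∫⁻ η, ENNReal.ofReal
      (|((typeMartingale s₀ (k + 1) η).toReal - (totalWeight s₀ (k + 1) η).toReal) -
        ((typeMartingale s₀ k η).toReal - (totalWeight s₀ k η).toReal)| ^ p) ∂treeLaw N ≤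
      ENNReal.ofReal (2 * p) * meanGen N s₀ k (innovationMoment N p) := by
  rw [← tsum_ite_eq_meanGen]
  refine lintegral_abs_rpow_le_of_hasSum h1 hp1 hp2 (fun u => u.length = k) ?_
  filter_upwards [ae_finite h1 hs] with η hη
  exact hasSum_innovation_gen hη k

/-- Moment bound for the difference of the two martingales. -/
lemma lintegral_abs_martingale_rpow_le (h1 : psi N 1 = 1) (hs : s₀.1 ≠ ⊤) {p : ℝ} (hp1 : 1 < p)
    (hp2 : p ≤ 2) (m : ℕ) :
    ∫⁻ η, ENNReal.ofReal
      (|((typeMartingale s₀ m η).toReal - (totalWeight s₀ m η).toReal) -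
        (s₀.2 - s₀.1.toReal)| ^ p) ∂treeLaw N ≤
      ENNReal.ofReal (2 * p) * ∑ k ∈ Finset.range m, meanGen N s₀ k (innovationMoment N p) := by
  have hsplit : ∀ {A : Type} [AddCommMonoid A] (u : Vertex) (x : A),
      (if u.length < m then x else 0) =
        ∑ k ∈ Finset.range m, if u.length = k then x else 0 := by
    intro A _ u x
    rw [Finset.sum_ite_eq]
    simp
  have hrhs : ∑ k ∈ Finset.range m, meanGen N s₀ k (innovationMoment N p) =
      ∑' u : Vertex, if u.length < m then
        ∫⁻ η, innovationMoment N p (stateAt s₀ η u) ∂treeLaw N else 0 := by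
    simp_rw [hsplit, ← tsum_ite_eq_meanGen]
    exact (Summable.tsum_finsetSum fun k _ => ENNReal.summable).symm
  rw [hrhs]
  refine lintegral_abs_rpow_le_of_hasSum h1 hp1 hp2 (fun u => u.length < m) ?_
  filter_upwards [ae_finite h1 hs] with η hη
  have hsum := hasSum_sum fun k (_ : k ∈ Finset.range m) => hasSum_innovation_gen hη k
  simp_rw [hsplit]
  have h0 : (typeMartingale s₀ 0 η).toReal - (totalWeight s₀ 0 η).toReal =
      s₀.2 - s₀.1.toReal := by
    simp [typeMartingale, totalType, totalWeight, genSum_zero, stateAt]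
  rw [Finset.sum_range_sub fun k =>
    (typeMartingale s₀ k η).toReal - (totalWeight s₀ k η).toReal, h0] at hsum
  exact hsum

end

end RangeTree

/-! ### Estimates for one generation -/

lemma ENNReal.exists_add_rpow_le {p a : ℝ} (hp : 1 < p) (ha : 1 < a) :
    ∃ C : ℝ≥0∞, C ≠ ⊤ ∧ ∀ u v : ℝ≥0∞,
      (u + v) ^ p ≤ ENNReal.ofReal a * u ^ p + C * v ^ p := by
  have ha0 : 0 < a := by linarith
  have hp1 : 0 < p - 1 := by linarith
  -- the weight `l` is such that `l * (1 / l) ^ p = a`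
  set l : ℝ := a ^ (-(1 / (p - 1))) with hl
  have hl0 : 0 < l := Real.rpow_pos_of_pos ha0 _
  have hl1 : l < 1 := Real.rpow_lt_one_of_one_lt_of_neg ha (by
    have : 0 < 1 / (p - 1) := by positivity
    linarith)
  have hla : l * (l⁻¹) ^ p = a := by
    rw [Real.inv_rpow hl0.le, ← Real.rpow_neg hl0.le]
    nth_rewrite 1 [← Real.rpow_one l]
    rw [← Real.rpow_add hl0, hl, ← Real.rpow_mul ha0.le]
    have : -(1 / (p - 1)) * (1 + -p) = 1 := by field_simp; ring
    rw [this, Real.rpow_one]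
  have hm0 : 0 < 1 - l := by linarith
  have key : ∀ {c : ℝ}, 0 < c → ∀ x : ℝ≥0∞, ENNReal.ofReal c * (ENNReal.ofReal c⁻¹ * x) ^ p =
      ENNReal.ofReal (c * c⁻¹ ^ p) * x ^ p := by
    intro c hc x
    rw [ENNReal.mul_rpow_of_nonneg _ _ (by linarith : 0 ≤ p), ← mul_assoc,
      ENNReal.ofReal_rpow_of_pos (inv_pos.2 hc), ← ENNReal.ofReal_mul hc.le]
  refine ⟨ENNReal.ofReal ((1 - l) * (1 - l)⁻¹ ^ p), ENNReal.ofReal_ne_top, fun u v => ?_⟩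
  have hcancel : ∀ {c : ℝ}, 0 < c → ∀ x : ℝ≥0∞,
      ENNReal.ofReal c * (ENNReal.ofReal c⁻¹ * x) = x := by
    intro c hc x
    rw [← mul_assoc, ← ENNReal.ofReal_mul hc.le, mul_inv_cancel₀ hc.ne', ENNReal.ofReal_one, one_mul]
  have hsum : ENNReal.ofReal l + ENNReal.ofReal (1 - l) = 1 := by
    rw [← ENNReal.ofReal_add hl0.le hm0.le]; simp
  have h := ENNReal.rpow_arith_mean_le_arith_mean2_rpow (ENNReal.ofReal l) (ENNReal.ofReal (1 - l))
    (ENNReal.ofReal l⁻¹ * u) (ENNReal.ofReal (1 - l)⁻¹ * v) hsum hp.le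
  rwa [hcancel hl0, hcancel hm0, key hl0, key hm0, hla] at h

namespace RangeTree

lemma add_rpow_le_two_mul {p : ℝ} (hp1 : 1 ≤ p) (hp2 : p ≤ 2) (u v : ℝ≥0∞) :
    (u + v) ^ p ≤ 2 * (u ^ p + v ^ p) := by
  refine (ENNReal.rpow_add_le_mul_rpow_add_rpow u v hp1).trans ?_
  gcongr
  conv_rhs => rw [← ENNReal.rpow_one 2]
  exact ENNReal.rpow_le_rpow_of_exponent_le (by norm_num) (by linarith)

lemma absDiff_triangle (x y z : ℝ≥0∞) : absDiff x z ≤ absDiff x y + absDiff y z := by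
  unfold absDiff
  calc (x - z) + (z - x) ≤ ((x - y) + (y - z)) + ((z - y) + (y - x)) :=
        add_le_add tsub_le_tsub_add_tsub tsub_le_tsub_add_tsub
    _ = _ := by ring

lemma absDiff_mul_le (x y a : ℝ≥0∞) : absDiff (x * a) (y * a) ≤ absDiff x y * a := by
  unfold absDiff
  rw [add_mul]
  refine add_le_add ?_ ?_ <;>
  · rw [tsub_le_iff_right, ← add_mul]
    gcongr
    exact le_tsub_add

lemma absDiff_eq_ofReal {x y : ℝ≥0∞} (hx : x ≠ ⊤) (hy : y ≠ ⊤) :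
    absDiff x y = ENNReal.ofReal |x.toReal - y.toReal| := by
  unfold absDiff
  rcases le_total x y with h | h
  · have h' := ENNReal.toReal_mono hy h
    rw [tsub_eq_zero_of_le h, zero_add, abs_sub_comm, abs_of_nonneg (by linarith),
      ← ENNReal.toReal_sub_of_le h hy, ENNReal.ofReal_toReal (ENNReal.sub_ne_top hy)]
  · have h' := ENNReal.toReal_mono hx h
    rw [tsub_eq_zero_of_le h, add_zero, abs_of_nonneg (by linarith),
      ← ENNReal.toReal_sub_of_le h hx, ENNReal.ofReal_toReal (ENNReal.sub_ne_top hx)]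

/-- The discrepancy between the type and the weight of a vertex. -/
noncomputable def discrepancy (p : ℝ) (s : State) : ℝ≥0∞ := absDiff s.2 s.1 ^ p

lemma measurable_discrepancy (p : ℝ) : Measurable (discrepancy p) :=
  (measurable_absDiff measurable_state_type measurable_fst).pow_const p

section

variable {N : Measure Progeny} [IsProbabilityMeasure N]

lemma ofReal_abs_innovation_le {s : State} (hs : s.1 ≠ ⊤) {z : Noise}
    (hZ : offspringType s z ≠ ⊤) (hS : ∑' j, z.1.weight j ≠ ⊤) :
    ENNReal.ofReal |innovation s z| ≤
      absDiff (offspringType s z) (s.2 * ∑' j, z.1.weight j) +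
        absDiff s.2 s.1 * absDiff (∑' j, z.1.weight j) 1 := by
  rw [absDiff_eq_ofReal hZ (ENNReal.mul_ne_top (by simp) hS), absDiff_eq_ofReal (by simp) hs,
    absDiff_eq_ofReal hS (by simp), ← ENNReal.ofReal_mul (abs_nonneg _),
    ← ENNReal.ofReal_add (abs_nonneg _) (by positivity), ← abs_mul]
  refine ENNReal.ofReal_le_ofReal ?_
  refine le_trans (le_of_eq ?_) (abs_add_le _ _)
  congr 1
  rw [ENNReal.toReal_mul, ENNReal.toReal_natCast, ENNReal.toReal_one, innovation]
  ring

lemma innovationMoment_le (h1 : psi N 1 = 1) {p : ℝ} (hp1 : 1 < p) (hp2 : p ≤ 2) {s : State}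
    (hs : s.1 ≠ ⊤) :
    innovationMoment N p s ≤
      4 * (1 + ∫⁻ x, (∑' j, x.weight j) ^ p ∂N) * (s.2 + discrepancy p s) := by
  set M := ∫⁻ x, (∑' j, x.weight j) ^ p ∂N with hM
  have hp0 : 0 ≤ p := by linarith
  have hZm : Measurable fun z => offspringType s z :=
    measurable_offspringType.comp measurable_prodMk_left
  have hZf : ∫⁻ z, offspringType s z ∂noiseLaw N ≠ ⊤ := by
    rw [lintegral_offspringType h1]; simp
  have hSf : ∫⁻ z, ∑' j, z.1.weight j ∂noiseLaw N ≠ ⊤ := by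
    rw [lintegral_noise_tsum_weight h1]; simp
  have hm1 : Measurable fun z : Noise =>
      absDiff (offspringType s z) (s.2 * ∑' j, z.1.weight j) ^ p :=
    (measurable_absDiff hZm (measurable_tsum_weight_fst.const_mul _)).pow_const p
  have hm2 : Measurable fun z : Noise => absDiff (∑' j, z.1.weight j) 1 ^ p :=
    (measurable_absDiff measurable_tsum_weight_fst measurable_const).pow_const p
  have hb1 : ∫⁻ z, absDiff (offspringType s z) (s.2 * ∑' j, z.1.weight j) ^ p ∂noiseLaw N ≤
      2 * s.2 * (1 + M) := lintegral_absDiff_tsum_type_le h1 s.2 hp1.le hp2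
  have hb2 : ∫⁻ z, absDiff (∑' j, z.1.weight j) 1 ^ p ∂noiseLaw N ≤ 2 * (1 + M) := by
    calc ∫⁻ z, absDiff (∑' j, z.1.weight j) 1 ^ p ∂noiseLaw N
        ≤ ∫⁻ z, 2 * ((∑' j, z.1.weight j) ^ p + 1) ∂noiseLaw N := by
          refine lintegral_mono fun z => ?_
          refine (ENNReal.rpow_le_rpow (absDiff_le_add _ _) hp0).trans ?_
          simpa using add_rpow_le_two_mul hp1.le hp2 (∑' j, z.1.weight j) 1
      _ = 2 * (1 + M) := by
          rw [lintegral_const_mul' 2 _ (by simp),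
            lintegral_add_left (measurable_tsum_weight_fst.pow_const p),
            lintegral_noiseLaw_fst (measurable_tsum_weight.pow_const p)]
          simp [hM, add_comm]
  calc innovationMoment N p s
      ≤ ∫⁻ z, 2 * (absDiff (offspringType s z) (s.2 * ∑' j, z.1.weight j) ^ p +
          discrepancy p s * absDiff (∑' j, z.1.weight j) 1 ^ p) ∂noiseLaw N := by
        refine lintegral_mono_ae ?_
        filter_upwards [ae_lt_top hZm hZf, ae_lt_top measurable_tsum_weight_fst hSf] with z hZ hS
        rw [← ENNReal.ofReal_rpow_of_nonneg (abs_nonneg _) hp0]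
        refine (ENNReal.rpow_le_rpow (ofReal_abs_innovation_le hs hZ.ne hS.ne) hp0).trans ?_
        refine (add_rpow_le_two_mul hp1.le hp2 _ _).trans ?_
        rw [ENNReal.mul_rpow_of_nonneg _ _ hp0]
        rfl
    _ = 2 * (∫⁻ z, absDiff (offspringType s z) (s.2 * ∑' j, z.1.weight j) ^ p ∂noiseLaw N +
          discrepancy p s * ∫⁻ z, absDiff (∑' j, z.1.weight j) 1 ^ p ∂noiseLaw N) := by
        rw [lintegral_const_mul' 2 _ (by simp), lintegral_add_left hm1,
          lintegral_const_mul _ hm2]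
    _ ≤ 2 * (2 * s.2 * (1 + M) + discrepancy p s * (2 * (1 + M))) := by gcongr
    _ = _ := by ring

/-- The discrepancy contracts in mean from one generation to the next, up to a term linear in the
type. -/
lemma exists_lintegral_discrepancy_child_le (h1 : psi N 1 = 1) {p : ℝ} (hp1 : 1 < p) (hp2 : p ≤ 2)
    (hψ : psi N p < 1) :
    ∃ θ C : ℝ≥0∞, θ < 1 ∧ C ≠ ⊤ ∧ ∀ s : State,
      ∫⁻ z, ∑' j, discrepancy p (child s z j) ∂noiseLaw N ≤ θ * discrepancy p s + C * s.2 := by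
  have hp0 : 0 ≤ p := by linarith
  have hψr : (psi N p).toReal < 1 := by
    rw [← ENNReal.toReal_one]
    exact (ENNReal.toReal_lt_toReal (hψ.trans ENNReal.one_lt_top).ne (by simp)).2 hψ
  have hψ0 : 0 ≤ (psi N p).toReal := ENNReal.toReal_nonneg
  set y := (psi N p).toReal with hy
  have hψy : psi N p = ENNReal.ofReal y :=
    (ENNReal.ofReal_toReal (hψ.trans ENNReal.one_lt_top).ne).symm
  set a : ℝ := 2 / (1 + y) with ha
  have ha1 : 1 < a := by rw [ha, lt_div_iff₀ (by linarith)]; linarith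
  have hay : a * y < 1 := by
    rw [ha, div_mul_eq_mul_div, div_lt_one (by linarith)]; linarith
  obtain ⟨C, hC, hle⟩ := ENNReal.exists_add_rpow_le hp1 ha1
  refine ⟨ENNReal.ofReal a * psi N p, C * (2 * (2 * (1 + psi N p) + 1)), ?_, ?_, fun s => ?_⟩
  · rw [hψy, ← ENNReal.ofReal_mul (by linarith), ENNReal.ofReal_lt_one]
    exact hay
  · exact ENNReal.mul_ne_top hC (ENNReal.mul_ne_top (by simp)
      (ENNReal.add_ne_top.2 ⟨ENNReal.mul_ne_top (by simp) (ENNReal.add_ne_top.2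
        ⟨by simp, (hψ.trans ENNReal.one_lt_top).ne⟩), by simp⟩))
  have hpt : ∀ (z : Noise) (j : ℕ), discrepancy p (child s z j) ≤
      ENNReal.ofReal a * discrepancy p s * z.1.weight j ^ p +
        C * (2 * (absDiff (z.2 s.2 j) (s.2 * z.1.weight j) ^ p +
          if z.2 s.2 j = 1 then 1 else 0)) := by
    intro z j
    have hone : absDiff ((if z.2 s.2 j = 1 then 0 else z.2 s.2 j : ℕ) : ℝ≥0∞) (z.2 s.2 j) ≤
        if z.2 s.2 j = 1 then 1 else 0 := by
      split_ifs with h <;> simp [absDiff, h]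
    have hind : (if z.2 s.2 j = 1 then 1 else 0 : ℝ≥0∞) ^ p =
        if z.2 s.2 j = 1 then 1 else 0 := by
      split_ifs
      · simp
      · exact ENNReal.zero_rpow_of_pos (by linarith)
    have htri : absDiff (child s z j).2 (child s z j).1 ≤
        absDiff s.2 s.1 * z.1.weight j + (absDiff (z.2 s.2 j) (s.2 * z.1.weight j) +
          if z.2 s.2 j = 1 then 1 else 0) := by
      calc absDiff (child s z j).2 (child s z j).1
          ≤ absDiff ((if z.2 s.2 j = 1 then 0 else z.2 s.2 j : ℕ) : ℝ≥0∞) (z.2 s.2 j) +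
            (absDiff (z.2 s.2 j) (s.2 * z.1.weight j) +
              absDiff (s.2 * z.1.weight j) (s.1 * z.1.weight j)) :=
            (absDiff_triangle _ _ _).trans (add_le_add le_rfl (absDiff_triangle _ _ _))
        _ ≤ (if z.2 s.2 j = 1 then 1 else 0) + (absDiff (z.2 s.2 j) (s.2 * z.1.weight j) +
              absDiff s.2 s.1 * z.1.weight j) := by
            gcongr
            exact absDiff_mul_le _ _ _
        _ = _ := by ring
    refine (ENNReal.rpow_le_rpow htri hp0).trans ((hle _ _).trans ?_)
    rw [ENNReal.mul_rpow_of_nonneg _ _ hp0, ← mul_assoc]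
    refine add_le_add le_rfl ?_
    gcongr
    refine (add_rpow_le_two_mul hp1.le hp2 _ _).trans ?_
    rw [hind]
  have hm1 : Measurable fun z : Noise => ∑' j, z.1.weight j ^ p :=
    Measurable.tsum fun j => ((measurable_weight j).comp measurable_fst).pow_const p
  have hm2 : Measurable fun z : Noise =>
      ∑' j, absDiff (z.2 s.2 j : ℝ≥0∞) (s.2 * z.1.weight j) ^ p :=
    Measurable.tsum fun j => (measurable_absDiff (measurable_type s.2 j)
      (((measurable_weight j).comp measurable_fst).const_mul _)).pow_const p
  have hm3 : Measurable fun z : Noise => ∑' j, (if z.2 s.2 j = 1 then 1 else 0 : ℝ≥0∞) :=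
    Measurable.tsum fun j => measurable_ite_type s.2 j 1 0
  have hb3 : ∫⁻ z, ∑' j, (if z.2 s.2 j = 1 then 1 else 0 : ℝ≥0∞) ∂noiseLaw N ≤ s.2 := by
    rw [← lintegral_tsum_type h1 s.2]
    refine lintegral_mono fun z => ENNReal.tsum_le_tsum fun j => ?_
    split_ifs with h <;> simp [h]
  calc ∫⁻ z, ∑' j, discrepancy p (child s z j) ∂noiseLaw N
      ≤ ∫⁻ z, (ENNReal.ofReal a * discrepancy p s * ∑' j, z.1.weight j ^ p +
          C * (2 * (∑' j, absDiff (z.2 s.2 j) (s.2 * z.1.weight j) ^ p +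
            ∑' j, if z.2 s.2 j = 1 then 1 else 0))) ∂noiseLaw N := by
        refine lintegral_mono fun z => ?_
        dsimp only
        rw [← ENNReal.tsum_add, ← ENNReal.tsum_mul_left, ← ENNReal.tsum_mul_left,
          ← ENNReal.tsum_mul_left, ← ENNReal.tsum_add]
        exact ENNReal.tsum_le_tsum fun j => hpt z j
    _ = ENNReal.ofReal a * discrepancy p s * psi N p +
          C * (2 * (∫⁻ z, ∑' j, absDiff (z.2 s.2 j) (s.2 * z.1.weight j) ^ p ∂noiseLaw N +
            ∫⁻ z, ∑' j, (if z.2 s.2 j = 1 then 1 else 0 : ℝ≥0∞) ∂noiseLaw N)) := by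
        rw [lintegral_add_left (hm1.const_mul _), lintegral_const_mul _ hm1,
          lintegral_const_mul' C _ hC, lintegral_const_mul' 2 _ (by simp),
          lintegral_add_left hm2, psi_eq_lintegral_tsum (by linarith),
          lintegral_noiseLaw_fst (Measurable.tsum fun j => (measurable_weight j).pow_const p)]
    _ ≤ ENNReal.ofReal a * discrepancy p s * psi N p +
          C * (2 * (2 * s.2 * (1 + psi N p) + s.2)) := by
        gcongr
        exact lintegral_tsum_absDiff_type_le h1 s.2 hp1.le hp2
    _ = _ := by ring

/-! ### A Lyapunov function for the killed types -/

lemma exists_two_mul_add_le {q : ℝ} (hq1 : 1 < q) (hq2 : q ≤ 2) {y : ℝ≥0∞} (hy : y < 1) :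
    ∃ i₀ : ℕ, ∀ i : ℕ, i₀ ≤ i → 2 * i + i * (i + 1) ^ (q - 1) * y ≤ (i : ℝ≥0∞) ^ q := by
  have hα : 0 < q - 1 := by linarith
  have hlim : Tendsto (fun i : ℕ => (i : ℝ≥0∞) ^ (q - 1)) atTop (𝓝 ⊤) :=
    (ENNReal.tendsto_rpow_at_top hα).comp ENNReal.tendsto_nat_nhds_top
  have h1y : 1 - y ≠ 0 := (tsub_pos_of_lt hy).ne'
  have hc : 3 / (1 - y) < ⊤ := ENNReal.div_lt_top (by simp) h1y
  obtain ⟨i₀, hi₀⟩ := (hlim.eventually (lt_mem_nhds hc)).exists_forall_of_atTop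
  refine ⟨i₀, fun i hi => ?_⟩
  set I := (i : ℝ≥0∞) ^ (q - 1) with hI
  have hI3 : 3 ≤ (1 - y) * I := by
    have h := (hi₀ i hi).le
    rw [ENNReal.div_le_iff h1y (by simp)] at h
    rwa [mul_comm]
  have hiq : (i : ℝ≥0∞) ^ q = i * I := by
    rw [hI]
    conv_rhs => enter [1]; rw [← ENNReal.rpow_one (i : ℝ≥0∞)]
    rw [← ENNReal.rpow_add_of_nonneg _ _ zero_le_one hα.le]
    congr 1; ring
  rw [hiq]
  calc 2 * (i : ℝ≥0∞) + i * (i + 1) ^ (q - 1) * y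
      ≤ 2 * i + i * (I + 1 ^ (q - 1)) * y := by
        gcongr
        exact ENNReal.rpow_add_le_add_rpow _ _ hα.le (by linarith)
    _ = i * (2 + y + y * I) := by rw [ENNReal.one_rpow]; ring
    _ ≤ i * (2 + 1 + y * I) := by gcongr
    _ = i * (3 + y * I) := by norm_num
    _ ≤ i * ((1 - y) * I + y * I) := by gcongr
    _ = i * I := by rw [← add_mul, tsub_add_cancel_of_le hy.le, one_mul]

/-- The Lyapunov function `i ↦ i^q + D i`, where `i` is the type. -/
noncomputable def lyapunov (q : ℝ) (D : ℝ≥0∞) (s : State) : ℝ≥0∞ := (s.2 : ℝ≥0∞) ^ q + D * s.2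

lemma measurable_lyapunov (q : ℝ) (D : ℝ≥0∞) : Measurable (lyapunov q D) :=
  (measurable_state_type.pow_const q).add (measurable_state_type.const_mul D)

/-- The function `i ↦ i^q + D i` decreases in mean from one generation to the next by at least the
type. For large types this is due to `ψ(q) < 1`; the small types have children of type `1` with a
probability bounded below, and a large `D` turns this into a decrease. -/
lemma exists_lyapunov (h1 : psi N 1 = 1) {q : ℝ} (hq1 : 1 < q) (hq2 : q ≤ 2) (hψ : psi N q < 1) :
    ∃ D : ℝ≥0∞, D ≠ ⊤ ∧ ∀ s : State,
      s.2 + ∫⁻ z, ∑' j, lyapunov q D (child s z j) ∂noiseLaw N ≤ lyapunov q D s := by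
  obtain ⟨i₀, hi₀⟩ := exists_two_mul_add_le hq1 hq2 hψ
  set B : ℕ → ℝ≥0∞ := fun i => 2 * i + i * (i + 1) ^ (q - 1) * psi N q with hB
  set π : ℕ → ℝ≥0∞ := fun i =>
    ∫⁻ z, ∑' j, (if z.2 i j = 1 then 1 else 0 : ℝ≥0∞) ∂noiseLaw N with hπ
  have hπ0 : ∀ i, i ≠ 0 → π i ≠ 0 := fun i hi => lintegral_tsum_type_eq_one_ne_zero h1 hi
  have hπi : ∀ i, π i ≤ i := by
    intro i
    rw [← lintegral_tsum_type h1 i]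
    refine lintegral_mono fun z => ENNReal.tsum_le_tsum fun j => ?_
    split_ifs with h <;> simp [h]
  have hBf : ∀ i, B i ≠ ⊤ := fun i => by
    refine ENNReal.add_ne_top.2 ⟨ENNReal.mul_ne_top (by simp) (by simp), ENNReal.mul_ne_top
      (ENNReal.mul_ne_top (by simp) (ENNReal.rpow_ne_top_of_nonneg (by linarith) (by simp)))
      (hψ.trans ENNReal.one_lt_top).ne⟩
  set D : ℝ≥0∞ := ∑ i ∈ (Finset.range i₀).erase 0, B i / π i with hD
  have hDf : D ≠ ⊤ := ENNReal.sum_ne_top.2 fun i hi =>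
    (ENNReal.div_lt_top (hBf i) (hπ0 i (Finset.ne_of_mem_erase hi))).ne
  have hbal : ∀ i : ℕ, B i ≤ (i : ℝ≥0∞) ^ q + D * π i := by
    intro i
    rcases le_or_gt i₀ i with hi | hi
    · exact (hi₀ i hi).trans le_self_add
    · rcases eq_or_ne i 0 with rfl | h0
      · simp [hB]
      · have hmem : i ∈ (Finset.range i₀).erase 0 := Finset.mem_erase.2 ⟨h0, Finset.mem_range.2 hi⟩
        have hle : B i / π i ≤ D := Finset.single_le_sum (f := fun i => B i / π i)
          (fun _ _ => zero_le) hmem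
        have hπt : π i ≠ ⊤ := ne_top_of_le_ne_top (by simp) (hπi i)
        rw [ENNReal.div_le_iff (hπ0 i h0) hπt] at hle
        exact hle.trans le_add_self
  refine ⟨D, hDf, fun s => ?_⟩
  set i := s.2 with hi
  have hpt : ∀ (z : Noise) (j : ℕ), lyapunov q D (child s z j) +
      D * (if z.2 i j = 1 then 1 else 0) ≤ (z.2 i j : ℝ≥0∞) ^ q + D * z.2 i j := by
    intro z j
    simp only [lyapunov, child]
    split_ifs with h
    · simp [hi ▸ h, ENNReal.zero_rpow_of_pos (show 0 < q by linarith)]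
    · simp [← hi]
  have hm1 : Measurable fun z : Noise => ∑' j, lyapunov q D (child s z j) :=
    Measurable.tsum fun j => (measurable_lyapunov q D).comp
      ((measurable_child j).comp measurable_prodMk_left)
  have hm2 : Measurable fun z : Noise => ∑' j, (z.2 i j : ℝ≥0∞) ^ q :=
    Measurable.tsum fun j => (measurable_type i j).pow_const q
  have hm3 : Measurable fun z : Noise => ∑' j, (if z.2 i j = 1 then 1 else 0 : ℝ≥0∞) :=
    Measurable.tsum fun j => measurable_ite_type i j 1 0
  have hm4 : Measurable fun z : Noise => ∑' j, (z.2 i j : ℝ≥0∞) :=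
    Measurable.tsum fun j => measurable_type i j
  have hsum : ∫⁻ z, ∑' j, lyapunov q D (child s z j) ∂noiseLaw N + D * π i ≤
      (i + i * (i + 1) ^ (q - 1) * psi N q) + D * i := by
    calc ∫⁻ z, ∑' j, lyapunov q D (child s z j) ∂noiseLaw N + D * π i
        = ∫⁻ z, ∑' j, (lyapunov q D (child s z j) +
            D * (if z.2 i j = 1 then 1 else 0)) ∂noiseLaw N := by
          simp_rw [ENNReal.tsum_add, ENNReal.tsum_mul_left]
          rw [lintegral_add_left hm1, lintegral_const_mul _ hm3]
      _ ≤ ∫⁻ z, ∑' j, ((z.2 i j : ℝ≥0∞) ^ q + D * z.2 i j) ∂noiseLaw N :=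
          lintegral_mono fun z => ENNReal.tsum_le_tsum fun j => hpt z j
      _ = ∫⁻ z, ∑' j, (z.2 i j : ℝ≥0∞) ^ q ∂noiseLaw N + D * i := by
          simp_rw [ENNReal.tsum_add, ENNReal.tsum_mul_left]
          rw [lintegral_add_left hm2, lintegral_const_mul _ hm4, lintegral_tsum_type h1]
      _ ≤ _ := by
          gcongr
          exact lintegral_tsum_type_rpow_le h1 i hq1.le hq2
  have hfin : D * π i ≠ ⊤ :=
    ENNReal.mul_ne_top hDf (ne_top_of_le_ne_top (by simp) (hπi i))
  rw [← ENNReal.add_le_add_iff_right hfin]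
  calc (i : ℝ≥0∞) + ∫⁻ z, ∑' j, lyapunov q D (child s z j) ∂noiseLaw N + D * π i
      ≤ i + ((i + i * (i + 1) ^ (q - 1) * psi N q) + D * i) := by
        rw [add_assoc]; gcongr
    _ = B i + D * i := by simp only [hB]; ring
    _ ≤ (i ^ q + D * π i) + D * i := by gcongr; exact hbal i
    _ = lyapunov q D s + D * π i := by simp only [lyapunov, ← hi]; ring

/-! ### Summation over the generations -/

variable {s₀ : State}

lemma sum_meanGen_type_le {q : ℝ} {D : ℝ≥0∞}
    (h : ∀ s : State,
      s.2 + ∫⁻ z, ∑' j, lyapunov q D (child s z j) ∂noiseLaw N ≤ lyapunov q D s) (m : ℕ) :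
    ∑ k ∈ Finset.range m, meanGen N s₀ k (fun s => (s.2 : ℝ≥0∞)) ≤ lyapunov q D s₀ := by
  have hind : ∑ k ∈ Finset.range m, meanGen N s₀ k (fun s => (s.2 : ℝ≥0∞)) +
      meanGen N s₀ m (lyapunov q D) ≤ lyapunov q D s₀ := by
    induction m with
    | zero => simp [meanGen_zero]
    | succ m ih =>
      refine le_trans ?_ ih
      rw [Finset.sum_range_succ, add_assoc, meanGen_succ m (measurable_lyapunov q D),
        ← meanGen_add m measurable_state_type]
      gcongr
      exact lintegral_mono fun η => genSum_mono fun u => h _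
  exact le_self_add.trans hind

lemma meanGen_discrepancy_succ_le {p : ℝ} {θ C : ℝ≥0∞}
    (h : ∀ s : State,
      ∫⁻ z, ∑' j, discrepancy p (child s z j) ∂noiseLaw N ≤ θ * discrepancy p s + C * s.2)
    (k : ℕ) :
    meanGen N s₀ (k + 1) (discrepancy p) ≤
      θ * meanGen N s₀ k (discrepancy p) + C * meanGen N s₀ k (fun s => (s.2 : ℝ≥0∞)) := by
  rw [meanGen_succ k (measurable_discrepancy p), ← meanGen_const_mul k θ (measurable_discrepancy p),
    ← meanGen_const_mul k C measurable_state_type,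
    ← meanGen_add k ((measurable_discrepancy p).const_mul θ)]
  exact lintegral_mono fun η => genSum_mono fun u => h _

lemma sum_meanGen_discrepancy_le {p : ℝ} {θ C E : ℝ≥0∞} (hθ : θ < 1)
    (h : ∀ s : State,
      ∫⁻ z, ∑' j, discrepancy p (child s z j) ∂noiseLaw N ≤ θ * discrepancy p s + C * s.2)
    (hE : ∀ m, ∑ k ∈ Finset.range m, meanGen N s₀ k (fun s => (s.2 : ℝ≥0∞)) ≤ E) (m : ℕ) :
    ∑ k ∈ Finset.range m, meanGen N s₀ k (discrepancy p) ≤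
      (discrepancy p s₀ + C * E) / (1 - θ) := by
  set B := (discrepancy p s₀ + C * E) / (1 - θ) with hB
  have h1θ : 1 - θ ≠ 0 := (tsub_pos_of_lt hθ).ne'
  have hBmul : (1 - θ) * B = discrepancy p s₀ + C * E :=
    ENNReal.mul_div_cancel h1θ (by simp)
  induction m with
  | zero => simp
  | succ m ih =>
    rw [Finset.sum_range_succ', meanGen_zero]
    calc ∑ k ∈ Finset.range m, meanGen N s₀ (k + 1) (discrepancy p) + discrepancy p s₀
        ≤ ∑ k ∈ Finset.range m, (θ * meanGen N s₀ k (discrepancy p) +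
            C * meanGen N s₀ k (fun s => (s.2 : ℝ≥0∞))) + discrepancy p s₀ := by
          gcongr with k hk
          exact meanGen_discrepancy_succ_le h k
      _ = θ * ∑ k ∈ Finset.range m, meanGen N s₀ k (discrepancy p) +
            C * ∑ k ∈ Finset.range m, meanGen N s₀ k (fun s => (s.2 : ℝ≥0∞)) +
            discrepancy p s₀ := by
          rw [Finset.sum_add_distrib, Finset.mul_sum, Finset.mul_sum]
      _ ≤ θ * B + C * E + discrepancy p s₀ := by
          gcongr
          exact hE m
      _ = θ * B + (1 - θ) * B := by rw [hBmul]; ring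
      _ = B := by rw [← add_mul, add_tsub_cancel_of_le hθ.le, one_mul]

end


section

variable {N : Measure Progeny} [IsProbabilityMeasure N] {s₀ : State}

lemma meanGen_innovationMoment_le (h1 : psi N 1 = 1) {p : ℝ} (hp1 : 1 < p) (hp2 : p ≤ 2)
    (hs : s₀.1 ≠ ⊤) (k : ℕ) :
    meanGen N s₀ k (innovationMoment N p) ≤
      4 * (1 + ∫⁻ x, (∑' j, x.weight j) ^ p ∂N) *
        (meanGen N s₀ k (fun s => (s.2 : ℝ≥0∞)) + meanGen N s₀ k (discrepancy p)) := by
  have hm : Measurable fun s : State => (s.2 : ℝ≥0∞) + discrepancy p s :=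
    measurable_state_type.add (measurable_discrepancy p)
  rw [← meanGen_add k measurable_state_type, ← meanGen_const_mul k _ hm]
  exact meanGen_mono hs k fun s hs' => innovationMoment_le h1 hp1 hp2 hs'

/-- The martingales of types and of weights, both started from `n`, differ in `L^p` by an amount whose
`p`-th power grows more slowly than `n^p`. -/
lemma exists_lintegral_abs_sub_rpow_le (h1 : psi N 1 = 1) {p q : ℝ} (hp1 : 1 < p) (hp2 : p ≤ 2)
    (hψp : psi N p < 1) (hM : ∫⁻ x, (∑' j, x.weight j) ^ p ∂N < ⊤) (hq1 : 1 < q) (hq2 : q ≤ 2)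
    (hψq : psi N q < 1) :
    ∃ K D : ℝ≥0∞, K ≠ ⊤ ∧ D ≠ ⊤ ∧ ∀ n m : ℕ,
      ∫⁻ η, ENNReal.ofReal (|(typeMartingale ((n : ℝ≥0∞), n) m η).toReal -
        (totalWeight ((n : ℝ≥0∞), n) m η).toReal| ^ p) ∂treeLaw N ≤ K * ((n : ℝ≥0∞) ^ q + D * n) := by
  obtain ⟨D, hD, hlyap⟩ := exists_lyapunov h1 hq1 hq2 hψq
  obtain ⟨θ, C, hθ, hC, hdisc⟩ := exists_lintegral_discrepancy_child_le h1 hp1 hp2 hψp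
  set M := ∫⁻ x, (∑' j, x.weight j) ^ p ∂N with hMdef
  have h1θ : 1 - θ ≠ 0 := (tsub_pos_of_lt hθ).ne'
  refine ⟨ENNReal.ofReal (2 * p) * (4 * (1 + M) * (1 + C / (1 - θ))), D, ?_, hD, fun n m => ?_⟩
  · exact ENNReal.mul_ne_top ENNReal.ofReal_ne_top (ENNReal.mul_ne_top (ENNReal.mul_ne_top (by simp)
      (ENNReal.add_ne_top.2 ⟨by simp, hM.ne⟩)) (ENNReal.add_ne_top.2
        ⟨by simp, (ENNReal.div_lt_top hC h1θ).ne⟩))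
  set s₀ : State := ((n : ℝ≥0∞), n) with hs₀
  have hs : s₀.1 ≠ ⊤ := by simp [hs₀]
  have hE := fun m => sum_meanGen_type_le (s₀ := s₀) hlyap m
  set E := lyapunov q D s₀ with hEdef
  have hd0 : discrepancy p s₀ = 0 := by
    simp [discrepancy, absDiff, hs₀, ENNReal.zero_rpow_of_pos (show 0 < p by linarith)]
  have hr := sum_meanGen_discrepancy_le hθ hdisc hE m
  rw [hd0, zero_add] at hr
  have hmart := lintegral_abs_martingale_rpow_le (s₀ := s₀) h1 hs hp1 hp2 m
  have h0 : ((s₀.2 : ℕ) : ℝ) - s₀.1.toReal = 0 := by simp [hs₀]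
  simp only [h0, sub_zero] at hmart
  refine hmart.trans ?_
  calc ENNReal.ofReal (2 * p) * ∑ k ∈ Finset.range m, meanGen N s₀ k (innovationMoment N p)
      ≤ ENNReal.ofReal (2 * p) * ∑ k ∈ Finset.range m, (4 * (1 + M) *
        (meanGen N s₀ k (fun s => (s.2 : ℝ≥0∞)) + meanGen N s₀ k (discrepancy p))) := by
        gcongr with k hk
        exact meanGen_innovationMoment_le h1 hp1 hp2 hs k
    _ = ENNReal.ofReal (2 * p) * (4 * (1 + M) *
        (∑ k ∈ Finset.range m, meanGen N s₀ k (fun s => (s.2 : ℝ≥0∞)) +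
          ∑ k ∈ Finset.range m, meanGen N s₀ k (discrepancy p))) := by
        rw [← Finset.mul_sum, Finset.sum_add_distrib]
    _ ≤ ENNReal.ofReal (2 * p) * (4 * (1 + M) * (E + C * E / (1 - θ))) := by
        gcongr
        exact hE m
    _ = _ := by
        rw [hEdef, lyapunov, ENNReal.mul_div_right_comm]
        ring

/-! ### Convergence of the additive martingale -/

lemma tendsto_of_tsum_absDiff_ne_top {x : ℕ → ℝ≥0∞} (h0 : x 0 ≠ ⊤)
    (h : ∑' k, absDiff (x (k + 1)) (x k) ≠ ⊤) :
    limsup x atTop < ⊤ ∧ Tendsto x atTop (𝓝 (limsup x atTop)) := by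
  have hd : ∀ k, absDiff (x (k + 1)) (x k) ≠ ⊤ := ENNReal.ne_top_of_tsum_ne_top h
  have hx : ∀ k, x k ≠ ⊤ := by
    intro k
    induction k with
    | zero => exact h0
    | succ k ih =>
      refine ne_top_of_le_ne_top (ENNReal.add_ne_top.2 ⟨hd k, ih⟩) ?_
      exact le_tsub_add.trans (by gcongr; exact le_self_add)
  have hsum : Summable fun k => dist (x k).toReal (x (k + 1)).toReal := by
    refine (ENNReal.summable_toReal h).congr fun k => ?_
    rw [absDiff_eq_ofReal (hx _) (hx _), ENNReal.toReal_ofReal (abs_nonneg _), dist_comm,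
      Real.dist_eq]
  obtain ⟨l, hl⟩ := cauchySeq_tendsto_of_complete (cauchySeq_of_summable_dist hsum)
  have ht : Tendsto x atTop (𝓝 (ENNReal.ofReal l)) :=
    (ENNReal.tendsto_ofReal hl).congr fun k => ENNReal.ofReal_toReal (hx k)
  rw [ht.limsup_eq]
  exact ⟨ENNReal.ofReal_lt_top, ht⟩

/-- The weight `e^{-V(u)}` of a vertex, and `0` for words which are not in the tree. -/
noncomputable def pathWeight (ω : Env) : Vertex → ℝ≥0∞
  | [] => 1
  | j :: u => pathWeight ω u * (ω u).weight j

open Classical in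
lemma pathWeight_eq (ω : Env) (u : Vertex) :
    pathWeight ω u =
      if InTree ω u then ENNReal.ofReal (Real.exp (-position ω u)) else 0 := by
  induction u with
  | nil => simp [pathWeight, InTree, position]
  | cons j u ih =>
    rw [pathWeight, ih, Progeny.weight]
    by_cases hu : InTree ω u
    · by_cases hj : (j : ℕ∞) < (ω u).1
      · have hju : InTree ω (j :: u) := ⟨hu, hj⟩
        rw [if_pos hu, dif_pos hj, if_pos hju, position, dif_pos hj,
          ← ENNReal.ofReal_mul (Real.exp_pos _).le, ← Real.exp_add]
        congr 2; ring
      · rw [dif_neg hj, mul_zero, if_neg fun h : InTree ω (j :: u) => hj h.2]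
    · rw [if_neg hu, zero_mul, if_neg fun h : InTree ω (j :: u) => hu h.1]

lemma measurable_pathWeight (u : Vertex) : Measurable fun ω => pathWeight ω u := by
  induction u with
  | nil => exact measurable_const
  | cons j u ih => exact ih.mul ((measurable_weight j).comp (measurable_pi_apply u))

lemma W_eq_genSum (k : ℕ) (ω : Env) : W k ω = genSum k (pathWeight ω) := by
  classical
  unfold W genSum
  refine (tsum_subtype {u : Vertex | u.length = k ∧ InTree ω u}
    (fun u => ENNReal.ofReal (Real.exp (-position ω u)))).trans ?_
  refine tsum_congr fun u => ?_
  rw [pathWeight_eq, Set.indicator_apply]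
  by_cases h : u.length = k <;> by_cases h' : InTree ω u <;> simp [h, h']

lemma measurable_W (k : ℕ) : Measurable (W k) := by
  have h : W k = fun ω => genSum k (pathWeight ω) := funext (W_eq_genSum k)
  rw [h]
  refine Measurable.tsum fun u => ?_
  by_cases hu : u.length = k
  · simpa [hu] using measurable_pathWeight u
  · simp [hu]

lemma measurable_Winf : Measurable Winf := Measurable.limsup measurable_W

lemma stateAt_fst (s₀ : State) (η : Vertex → Noise) (u : Vertex) :
    (stateAt s₀ η u).1 = s₀.1 * pathWeight (envOf η) u := by
  induction u with
  | nil => simp [stateAt, pathWeight]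
  | cons j u ih => rw [stateAt, child, pathWeight, ih, mul_assoc]; rfl

lemma totalWeight_eq (s₀ : State) (k : ℕ) (η : Vertex → Noise) :
    totalWeight s₀ k η = s₀.1 * W k (envOf η) := by
  rw [W_eq_genSum, ← genSum_const_mul]
  simp only [totalWeight, stateAt_fst]

lemma W_zero (ω : Env) : W 0 ω = 1 := by
  rw [W_eq_genSum, genSum_zero, pathWeight]

lemma lintegral_le_rpow_lintegral {Ω : Type*} [MeasurableSpace Ω] {ν : Measure Ω}
    [IsProbabilityMeasure ν] {f : Ω → ℝ≥0∞} (hf : Measurable f) {p : ℝ} (hp : 1 ≤ p) :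
    ∫⁻ ω, f ω ∂ν ≤ (∫⁻ ω, f ω ^ p ∂ν) ^ (1 / p) := by
  have hp0 : 0 < p := by linarith
  have h := ENNReal.lintegral_mul_norm_pow_le (μ := ν) (hf.pow_const p).aemeasurable
    (measurable_const (a := (1 : ℝ≥0∞))).aemeasurable (p := 1 / p) (q := 1 - 1 / p) (by positivity)
    (sub_nonneg.2 ((div_le_one hp0).2 hp)) (by ring)
  simp only [ENNReal.one_rpow, mul_one, lintegral_const, measure_univ] at h
  refine le_trans (le_of_eq (lintegral_congr fun ω => ?_)) h
  rw [← ENNReal.rpow_mul, mul_one_div_cancel hp0.ne', ENNReal.rpow_one]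

lemma meanGen_type_eq (s₀ : State) (k : ℕ) :
    meanGen N s₀ k (fun s => (s.2 : ℝ≥0∞)) = ∫⁻ η, totalType s₀ k η ∂treeLaw N := rfl

/-- The increments of the additive martingale are those of the difference of the two martingales
started from type `0`. -/
lemma lintegral_absDiff_W_rpow_le (h1 : psi N 1 = 1) {p : ℝ} (hp1 : 1 < p) (hp2 : p ≤ 2)
    {θ C : ℝ≥0∞}
    (hdisc : ∀ s : State,
      ∫⁻ z, ∑' j, discrepancy p (child s z j) ∂noiseLaw N ≤ θ * discrepancy p s + C * s.2)
    (k : ℕ) :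
    ∫⁻ η, absDiff (W (k + 1) (envOf η)) (W k (envOf η)) ^ p ∂treeLaw N ≤
      ENNReal.ofReal (2 * p) * (4 * (1 + ∫⁻ x, (∑' j, x.weight j) ^ p ∂N)) * θ ^ k := by
  set s₀ : State := (1, 0) with hs₀
  have hp0 : 0 < p := by linarith
  have hs : s₀.1 ≠ ⊤ := by simp [hs₀]
  have htype : ∀ k, ∫⁻ η, totalType s₀ k η ∂treeLaw N = 0 := fun k =>
    le_antisymm (by simpa [hs₀] using lintegral_totalType_le (s₀ := s₀) h1 k) zero_le
  have hdk : ∀ k, meanGen N s₀ k (discrepancy p) ≤ θ ^ k := by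
    intro k
    induction k with
    | zero => simp [meanGen_zero, discrepancy, absDiff, hs₀]
    | succ k ih =>
      refine (meanGen_discrepancy_succ_le hdisc k).trans ?_
      rw [meanGen_type_eq, htype, mul_zero, add_zero, pow_succ']
      gcongr
  have hinc := lintegral_abs_increment_rpow_le (s₀ := s₀) h1 hs hp1 hp2 k
  have hzero : ∀ k, ∀ᵐ η ∂treeLaw N, totalType s₀ k η = 0 ∧ killed s₀ k η = 0 := by
    intro k
    have hm : Measurable fun η => totalType s₀ (k + 1) η + killed s₀ k η :=
      (measurable_totalType s₀ (k + 1)).add (measurable_killed s₀ k)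
    have h2 := lintegral_totalType_succ_add_killed (s₀ := s₀) h1 k
    rw [htype, lintegral_eq_zero_iff hm] at h2
    filter_upwards [(lintegral_eq_zero_iff (measurable_totalType s₀ k)).1 (htype k), h2] with η h3 h4
    exact ⟨h3, (add_eq_zero.1 h4).2⟩
  calc ∫⁻ η, absDiff (W (k + 1) (envOf η)) (W k (envOf η)) ^ p ∂treeLaw N
      = ∫⁻ η, ENNReal.ofReal
          (|((typeMartingale s₀ (k + 1) η).toReal - (totalWeight s₀ (k + 1) η).toReal) -
          ((typeMartingale s₀ k η).toReal - (totalWeight s₀ k η).toReal)| ^ p) ∂treeLaw N := by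
        refine lintegral_congr_ae ?_
        filter_upwards [ae_finite h1 hs, ae_all_iff.2 hzero] with η hη hz
        have hM : ∀ m, typeMartingale s₀ m η = 0 := fun m => by
          simp [typeMartingale, hz]
        have hW : ∀ m, totalWeight s₀ m η = W m (envOf η) := fun m => by
          simp [totalWeight_eq, hs₀]
        rw [hM, hM, hW, hW, absDiff_eq_ofReal (hW (k + 1) ▸ (hη (k + 1)).1) (hW k ▸ (hη k).1),
          ENNReal.ofReal_rpow_of_nonneg (abs_nonneg _) hp0.le, abs_sub_comm]
        congr 3
        simp only [ENNReal.toReal_zero]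
        ring
    _ ≤ ENNReal.ofReal (2 * p) * meanGen N s₀ k (innovationMoment N p) := hinc
    _ ≤ ENNReal.ofReal (2 * p) * (4 * (1 + ∫⁻ x, (∑' j, x.weight j) ^ p ∂N) * θ ^ k) := by
        gcongr
        refine (meanGen_innovationMoment_le h1 hp1 hp2 hs k).trans ?_
        rw [meanGen_type_eq, htype, zero_add]
        gcongr
        exact hdk k
    _ = _ := by ring

lemma lintegral_tsum_absDiff_W_ne_top (h1 : psi N 1 = 1) {p : ℝ} (hp1 : 1 < p) (hp2 : p ≤ 2)
    (hψp : psi N p < 1) (hM : ∫⁻ x, (∑' j, x.weight j) ^ p ∂N < ⊤) :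
    ∫⁻ η, ∑' k, absDiff (W (k + 1) (envOf η)) (W k (envOf η)) ∂treeLaw N ≠ ⊤ := by
  obtain ⟨θ, C, hθ, -, hdisc⟩ := exists_lintegral_discrepancy_child_le h1 hp1 hp2 hψp
  have hp0 : 0 < p := by linarith
  have hm : ∀ k, Measurable fun η : Vertex → Noise =>
      absDiff (W (k + 1) (envOf η)) (W k (envOf η)) := fun k =>
    measurable_absDiff ((measurable_W _).comp measurable_envOf)
      ((measurable_W _).comp measurable_envOf)
  set A := ENNReal.ofReal (2 * p) * (4 * (1 + ∫⁻ x, (∑' j, x.weight j) ^ p ∂N)) with hA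
  have hAf : A ≠ ⊤ := ENNReal.mul_ne_top ENNReal.ofReal_ne_top (ENNReal.mul_ne_top (by simp)
    (ENNReal.add_ne_top.2 ⟨by simp, hM.ne⟩))
  rw [lintegral_tsum fun k => (hm k).aemeasurable]
  have hle : ∀ k, ∫⁻ η, absDiff (W (k + 1) (envOf η)) (W k (envOf η)) ∂treeLaw N ≤
      A ^ (1 / p) * (θ ^ (1 / p)) ^ k := by
    intro k
    refine (lintegral_le_rpow_lintegral (hm k) hp1.le).trans ?_
    refine (ENNReal.rpow_le_rpow (lintegral_absDiff_W_rpow_le h1 hp1 hp2 hdisc k)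
      (by positivity)).trans (le_of_eq ?_)
    rw [ENNReal.mul_rpow_of_nonneg _ _ (by positivity : 0 ≤ 1 / p)]
    congr 1
    rw [← ENNReal.rpow_natCast, ← ENNReal.rpow_natCast, ← ENNReal.rpow_mul, ← ENNReal.rpow_mul,
      mul_comm]
  refine ne_top_of_le_ne_top ?_ (ENNReal.tsum_le_tsum hle)
  rw [ENNReal.tsum_mul_left, ENNReal.tsum_geometric]
  refine ENNReal.mul_ne_top (ENNReal.rpow_ne_top_of_nonneg (by positivity) hAf) ?_
  rw [ENNReal.inv_ne_top]
  exact (tsub_pos_of_lt (ENNReal.rpow_lt_one hθ (by positivity))).ne'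

/-! ### The line of first vertices of type one -/

lemma ae_type_zero (h1 : psi N 1 = 1) :
    ∀ᵐ η ∂treeLaw N, ∀ (u : Vertex) (j : ℕ), (η u).2 0 j = 0 := by
  refine ae_all_iff.2 fun u => ?_
  have h0 : ∀ᵐ z ∂noiseLaw N, ∀ j, z.2 0 j = 0 := by
    have h := lintegral_tsum_type h1 0
    rw [Nat.cast_zero, lintegral_eq_zero_iff (Measurable.tsum fun j => measurable_type 0 j)] at h
    filter_upwards [h] with z hz j
    simpa using ENNReal.tsum_eq_zero.1 hz j
  exact (measurePreserving_eval_infinitePi (fun _ : Vertex => noiseLaw N) u).quasiMeasurePreserving.ae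
    h0

open Classical in
/-- If vertices of type `0` only have children of type `0`, then the killed type of a vertex is its
type or `0`, according to whether it is before the first vertex of type `1` or not. -/
lemma stateAt_snd {η : Vertex → Noise} (hη : ∀ (u : Vertex) (j : ℕ), (η u).2 0 j = 0) (c : ℝ≥0∞)
    (n : ℕ) (u : Vertex) :
    (stateAt (c, n) η u).2 =
      if ∀ w, w ≠ [] → w <:+ u → edgeLocalTime n (typesOf η) w ≠ 1 then
        edgeLocalTime n (typesOf η) u else 0 := by
  induction u with
  | nil =>
    rw [if_pos fun w hw hs => absurd (List.suffix_nil.1 hs) hw]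
    rfl
  | cons j u ih =>
    have hiff : (∀ w, w ≠ [] → w <:+ j :: u → edgeLocalTime n (typesOf η) w ≠ 1) ↔
        edgeLocalTime n (typesOf η) (j :: u) ≠ 1 ∧
          ∀ w, w ≠ [] → w <:+ u → edgeLocalTime n (typesOf η) w ≠ 1 := by
      constructor
      · intro h
        exact ⟨h _ (by simp) List.suffix_rfl, fun w hw hs => h w hw (hs.trans (List.suffix_cons _ _))⟩
      · rintro ⟨h2, h3⟩ w hw hs
        rcases List.suffix_cons_iff.1 hs with rfl | hs
        · exact h2
        · exact h3 w hw hs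
    simp only [stateAt, child]
    rw [ih, if_congr hiff rfl rfl]
    by_cases hu : ∀ w, w ≠ [] → w <:+ u → edgeLocalTime n (typesOf η) w ≠ 1
    · rw [if_pos hu]
      have e : (η u).2 (edgeLocalTime n (typesOf η) u) j = edgeLocalTime n (typesOf η) (j :: u) := rfl
      rw [e]
      by_cases h2 : edgeLocalTime n (typesOf η) (j :: u) = 1
      · rw [if_pos h2, if_neg fun h => h.1 h2]
      · rw [if_neg h2, if_pos ⟨h2, hu⟩]
    · rw [if_neg hu, hη, if_neg zero_ne_one, if_neg fun h => hu h.2]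

lemma cons_mem_lineOne_iff {η : Vertex → Noise} (hη : ∀ (u : Vertex) (j : ℕ), (η u).2 0 j = 0)
    (c : ℝ≥0∞) (n j : ℕ) (u : Vertex) :
    j :: u ∈ lineOne (edgeLocalTime n (typesOf η)) [] ↔
      (η u).2 (stateAt (c, n) η u).2 j = 1 := by
  classical
  have hiff : j :: u ∈ lineOne (edgeLocalTime n (typesOf η)) [] ↔
      edgeLocalTime n (typesOf η) (j :: u) = 1 ∧
        ∀ w, w ≠ [] → w <:+ u → edgeLocalTime n (typesOf η) w ≠ 1 := by
    constructor
    · rintro ⟨-, h2, h3⟩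
      refine ⟨h2, fun w hw hs => h3 w ⟨List.nil_suffix, hw.symm⟩
        ⟨hs.trans (List.suffix_cons _ _), ?_⟩⟩
      rintro rfl
      have := hs.length_le
      simp at this
    · rintro ⟨h2, h3⟩
      refine ⟨⟨List.nil_suffix, by simp⟩, h2, fun w hw hs => h3 w hw.2.symm ?_⟩
      exact (List.suffix_cons_iff.1 hs.1).resolve_left hs.2
  rw [hiff, stateAt_snd hη c n u]
  by_cases hu : ∀ w, w ≠ [] → w <:+ u → edgeLocalTime n (typesOf η) w ≠ 1
  · rw [if_pos hu, and_iff_left hu]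
    rfl
  · rw [if_neg hu, hη]
    simp [hu]

open Classical in
lemma L1_eq_tsum (β : Vertex → ℕ) : L1 β = ∑' v, if v ∈ lineOne β [] then 1 else 0 := by
  rw [L1, ← ENNReal.tsum_set_one, tsum_subtype (lineOne β []) (fun _ => (1 : ℝ≥0∞))]
  exact tsum_congr fun v => Set.indicator_apply _ _ _

lemma L1_eq_tsum_killed {η : Vertex → Noise} (hη : ∀ (u : Vertex) (j : ℕ), (η u).2 0 j = 0)
    (c : ℝ≥0∞) (n : ℕ) :
    L1 (edgeLocalTime n (typesOf η)) = ∑' k, killed (c, n) k η := by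
  classical
  set f : Vertex → ℝ≥0∞ := fun v =>
    if v ∈ lineOne (edgeLocalTime n (typesOf η)) [] then 1 else 0 with hf
  have hgen : ∑' v, f v = ∑' k, genSum k f := by
    unfold genSum
    rw [ENNReal.tsum_comm]
    refine tsum_congr fun v => ?_
    rw [tsum_eq_single v.length fun k hk => if_neg hk.symm, if_pos rfl]
  rw [L1_eq_tsum, hgen, tsum_eq_zero_add' ENNReal.summable, genSum_zero]
  have h0 : f [] = 0 := if_neg fun h => h.1.2 rfl
  rw [h0, zero_add]
  refine tsum_congr fun k => ?_
  rw [genSum_succ]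
  simp only [killed, hf, cons_mem_lineOne_iff hη c]

lemma measurable_L1 : Measurable L1 := by
  classical
  have h : L1 = fun β => ∑' v, if v ∈ lineOne β [] then 1 else 0 := funext L1_eq_tsum
  rw [h]
  have hone : ∀ w : Vertex, MeasurableSet {β : Vertex → ℕ | β w = 1} := fun w =>
    measurable_pi_apply w (measurableSet_singleton 1)
  refine Measurable.tsum fun v => Measurable.ite ?_ measurable_const measurable_const
  have hset : {β : Vertex → ℕ | v ∈ lineOne β []} = {_β | StrictAncestor [] v} ∩
      ({β | β v = 1} ∩ ⋂ w : Vertex, ⋂ (_ : StrictAncestor [] w), ⋂ (_ : StrictAncestor w v),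
        {β | β w = 1}ᶜ) := by
    ext β
    simp [lineOne]
  rw [hset]
  exact (MeasurableSet.const _).inter ((hone v).inter (MeasurableSet.iInter fun w =>
    MeasurableSet.iInter fun _ => MeasurableSet.iInter fun _ => (hone w).compl))

lemma ae_tendsto_typeMartingale (h1 : psi N 1 = 1) {q : ℝ} (hq1 : 1 < q) (hq2 : q ≤ 2)
    (hψq : psi N q < 1) (c : ℝ≥0∞) (n : ℕ) :
    ∀ᵐ η ∂treeLaw N, L1 (edgeLocalTime n (typesOf η)) ≠ ⊤ ∧
      Tendsto (fun m => typeMartingale (c, n) m η) atTop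
        (𝓝 (L1 (edgeLocalTime n (typesOf η)))) := by
  obtain ⟨D, hD, hlyap⟩ := exists_lyapunov h1 hq1 hq2 hψq
  have hE : ∑' k, ∫⁻ η, totalType (c, n) k η ∂treeLaw N ≠ ⊤ := by
    refine ne_top_of_le_ne_top ?_ (ENNReal.tsum_le_of_sum_range_le
      fun m => sum_meanGen_type_le (s₀ := (c, n)) hlyap m)
    exact ENNReal.add_ne_top.2 ⟨ENNReal.rpow_ne_top_of_nonneg (by linarith) (by simp),
      ENNReal.mul_ne_top hD (by simp)⟩
  have hkm := measurable_killed (c, n)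
  have hK : ∑' k, ∫⁻ η, killed (c, n) k η ∂treeLaw N ≠ ⊤ := by
    refine ne_top_of_le_ne_top hE (ENNReal.tsum_le_tsum fun k => ?_)
    rw [← lintegral_totalType_succ_add_killed h1 k]
    exact lintegral_mono fun η => le_add_self
  rw [← lintegral_tsum fun k => (measurable_totalType _ k).aemeasurable] at hE
  rw [← lintegral_tsum fun k => (hkm k).aemeasurable] at hK
  filter_upwards [ae_type_zero h1, ae_lt_top (Measurable.tsum fun k => measurable_totalType _ k) hE,
    ae_lt_top (Measurable.tsum hkm) hK] with η hη hX hR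
  rw [L1_eq_tsum_killed hη c n]
  refine ⟨hR.ne, ?_⟩
  have h2 := ENNReal.summable.hasSum.tendsto_sum_nat (f := fun k => killed (c, n) k η)
  have h3 := ENNReal.tendsto_atTop_zero_of_tsum_ne_top hX.ne
  simpa [typeMartingale] using h2.add h3

/-- The moment bound passes to the limit by Fatou's lemma. -/
lemma exists_lintegral_absDiff_L1_le (h1 : psi N 1 = 1) {p q : ℝ} (hp1 : 1 < p) (hp2 : p ≤ 2)
    (hψp : psi N p < 1) (hM : ∫⁻ x, (∑' j, x.weight j) ^ p ∂N < ⊤) (hq1 : 1 < q) (hq2 : q ≤ 2)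
    (hψq : psi N q < 1) :
    ∃ K D : ℝ≥0∞, K ≠ ⊤ ∧ D ≠ ⊤ ∧ ∀ n : ℕ,
      ∫⁻ η, absDiff (L1 (edgeLocalTime n (typesOf η))) (n * Winf (envOf η)) ^ p ∂treeLaw N ≤
        K * ((n : ℝ≥0∞) ^ q + D * n) := by
  obtain ⟨K, D, hK, hD, hbound⟩ := exists_lintegral_abs_sub_rpow_le h1 hp1 hp2 hψp hM hq1 hq2 hψq
  refine ⟨K, D, hK, hD, fun n => ?_⟩
  set s₀ : State := ((n : ℝ≥0∞), n) with hs₀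
  set g : ℕ → (Vertex → Noise) → ℝ := fun m η =>
    (typeMartingale s₀ m η).toReal - (totalWeight s₀ m η).toReal with hg
  have hgm : ∀ m, Measurable (g m) := fun m =>
    ((Finset.measurable_sum _ fun k _ => measurable_killed s₀ k).add (measurable_totalType s₀ m)).ennreal_toReal.sub
      (measurable_totalWeight s₀ m).ennreal_toReal
  have hWm : Measurable fun η : Vertex → Noise =>
      ∑' k, absDiff (W (k + 1) (envOf η)) (W k (envOf η)) :=
    Measurable.tsum fun k => measurable_absDiff ((measurable_W _).comp measurable_envOf)
      ((measurable_W _).comp measurable_envOf)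
  have hlim : ∀ᵐ η ∂treeLaw N,
      absDiff (L1 (edgeLocalTime n (typesOf η))) (n * Winf (envOf η)) ^ p =
        liminf (fun m => ENNReal.ofReal (|g m η| ^ p)) atTop := by
    filter_upwards [ae_tendsto_typeMartingale h1 hq1 hq2 hψq n n,
      ae_lt_top hWm (lintegral_tsum_absDiff_W_ne_top h1 hp1 hp2 hψp hM)] with η hL hW
    obtain ⟨hWf, hWt⟩ := tendsto_of_tsum_absDiff_ne_top
      (x := fun k => W k (envOf η)) (by simp [W_zero]) hW.ne
    have hnW : (n : ℝ≥0∞) * Winf (envOf η) ≠ ⊤ := ENNReal.mul_ne_top (by simp) hWf.ne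
    have ht1 := (ENNReal.tendsto_toReal hL.1).comp hL.2
    have ht2 : Tendsto (fun m => (totalWeight s₀ m η).toReal) atTop
        (𝓝 ((n : ℝ≥0∞) * Winf (envOf η)).toReal) := by
      refine (ENNReal.tendsto_toReal hnW).comp ?_
      simp only [totalWeight_eq]
      exact ENNReal.Tendsto.const_mul hWt (Or.inr (by simp [hs₀]))
    have hc : Continuous fun x : ℝ => ENNReal.ofReal (|x| ^ p) :=
      ENNReal.continuous_ofReal.comp ((Real.continuous_rpow_const (by linarith)).comp continuous_abs)
    have ht := (hc.tendsto _).comp (ht1.sub ht2)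
    rw [absDiff_eq_ofReal hL.1 hnW, ENNReal.ofReal_rpow_of_nonneg (abs_nonneg _) (by linarith)]
    exact ht.liminf_eq.symm
  rw [lintegral_congr_ae hlim]
  refine (lintegral_liminf_le fun m => measurable_ofReal_abs_rpow (hgm m) p).trans ?_
  refine liminf_le_of_le (by isBoundedDefault) fun b hb => ?_
  obtain ⟨m, hm⟩ := hb.exists
  exact hm.trans (hbound n m)

lemma tendsto_natCast_rpow_mul_inv {q p : ℝ} (hqp : q < p) :
    Tendsto (fun n : ℕ => (n : ℝ≥0∞) ^ q * ((n : ℝ≥0∞)⁻¹) ^ p) atTop (𝓝 0) := by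
  have hlim : Tendsto (fun n : ℕ => ((n : ℝ≥0∞) ^ (p - q))⁻¹) atTop (𝓝 0) := by
    have h := (ENNReal.tendsto_rpow_at_top (sub_pos.2 hqp)).comp ENNReal.tendsto_nat_nhds_top
    have h' := (continuous_inv.tendsto (⊤ : ℝ≥0∞)).comp h
    rwa [ENNReal.inv_top] at h'
  refine hlim.congr' ?_
  filter_upwards [eventually_ge_atTop 1] with n hn
  have hn0 : (n : ℝ≥0∞) ≠ 0 := by simp; omega
  rw [ENNReal.inv_rpow, ← ENNReal.rpow_neg, ← ENNReal.rpow_neg, ← ENNReal.rpow_add _ _ hn0 (by simp)]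
  congr 1; ring

end

end RangeTree

theorem proposition3p3 (N : Measure RangeTree.Progeny) [IsProbabilityMeasure N] (κ : ℝ)
    (hκ : RangeTree.kappa N = (κ : EReal)) (hκ_gt : 1 < κ) (hκ_le : κ ≤ 2)
    (hc : RangeTree.HypC N) (hk : RangeTree.HypKappa N κ)
    (α : ℝ) (hα_pos : 0 < α) (hα_lt : α < κ - 1) :
    (∀ᵐ ω ∂(RangeTree.brwLaw N), RangeTree.Winf ω < ⊤ ∧
      Tendsto (fun k => RangeTree.W k ω) atTop (𝓝 (RangeTree.Winf ω))) ∧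
    Tendsto (fun n : ℕ => RangeTree.annealedExp N n fun ω β =>
      RangeTree.absDiff (RangeTree.L1 β / (n : ℝ≥0∞)) (RangeTree.Winf ω) ^ (1 + α))
      atTop (𝓝 0) := by
  have h1 := RangeTree.psi_one hκ hκ_gt hc
  have hp1 : 1 < 1 + α := by linarith
  have hp2 : 1 + α ≤ 2 := by linarith
  have hψp := RangeTree.psi_lt_one hκ hp1 (by linarith)
  have hM := RangeTree.lintegral_tsum_weight_rpow_lt_top hk (r := 1 + α) (by linarith) (by linarith)
  have hq1 : 1 < 1 + α / 2 := by linarith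
  have hψq := RangeTree.psi_lt_one hκ hq1 (by linarith)
  constructor
  · have hm : Measurable fun ω : RangeTree.Env =>
        ∑' k, RangeTree.absDiff (RangeTree.W (k + 1) ω) (RangeTree.W k ω) :=
      Measurable.tsum fun k =>
        RangeTree.measurable_absDiff (RangeTree.measurable_W _) (RangeTree.measurable_W _)
    have hfin := RangeTree.lintegral_tsum_absDiff_W_ne_top h1 hp1 hp2 hψp hM
    rw [← RangeTree.lintegral_brwLaw_eq_treeLaw N hm] at hfin
    filter_upwards [ae_lt_top hm hfin] with ω hω
    exact RangeTree.tendsto_of_tsum_absDiff_ne_top (x := fun k => RangeTree.W k ω)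
      (by simp [RangeTree.W_zero]) hω.ne
  · obtain ⟨K, D, hK, hD, hbound⟩ := RangeTree.exists_lintegral_absDiff_L1_le h1 hp1 hp2 hψp hM
      hq1 (by linarith) hψq
    have hup : Tendsto (fun n : ℕ => K * ((n : ℝ≥0∞) ^ (1 + α / 2) * ((n : ℝ≥0∞)⁻¹) ^ (1 + α) +
        D * ((n : ℝ≥0∞) ^ (1 : ℝ) * ((n : ℝ≥0∞)⁻¹) ^ (1 + α)))) atTop (𝓝 0) := by
      have ht1 := RangeTree.tendsto_natCast_rpow_mul_inv (q := 1 + α / 2) (p := 1 + α)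
        (by linarith)
      have ht2 := RangeTree.tendsto_natCast_rpow_mul_inv (q := 1) (p := 1 + α) hp1
      have ht := ENNReal.Tendsto.const_mul
        (ht1.add (ENNReal.Tendsto.const_mul ht2 (Or.inr hD))) (Or.inr hK)
      simpa using ht
    refine tendsto_of_tendsto_of_tendsto_of_le_of_le' tendsto_const_nhds hup
      (Eventually.of_forall fun n => zero_le) ?_
    filter_upwards [eventually_ge_atTop 1] with n hn
    have hn0 : (n : ℝ≥0∞) ≠ 0 := by simp; omega
    have hFm : Measurable fun z : RangeTree.Env × (RangeTree.Vertex → ℕ) =>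
        RangeTree.absDiff (RangeTree.L1 z.2 / (n : ℝ≥0∞)) (RangeTree.Winf z.1) ^ (1 + α) :=
      (RangeTree.measurable_absDiff
        ((RangeTree.measurable_L1.comp measurable_snd).div measurable_const)
        (RangeTree.measurable_Winf.comp measurable_fst)).pow_const _
    rw [RangeTree.annealedExp_eq_treeLaw N n (F := fun ω β =>
      RangeTree.absDiff (RangeTree.L1 β / (n : ℝ≥0∞)) (RangeTree.Winf ω) ^ (1 + α)) hFm]
    have hninv : ((n : ℝ≥0∞)⁻¹) ^ (1 + α) ≠ ⊤ :=
      ENNReal.rpow_ne_top_of_nonneg (by linarith) (ENNReal.inv_ne_top.2 hn0)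
    calc ∫⁻ η, RangeTree.absDiff
          (RangeTree.L1 (RangeTree.edgeLocalTime n (RangeTree.typesOf η)) / (n : ℝ≥0∞))
          (RangeTree.Winf (RangeTree.envOf η)) ^ (1 + α) ∂(RangeTree.treeLaw N)
        ≤ ∫⁻ η, RangeTree.absDiff (RangeTree.L1 (RangeTree.edgeLocalTime n (RangeTree.typesOf η)))
            (n * RangeTree.Winf (RangeTree.envOf η)) ^ (1 + α) * ((n : ℝ≥0∞)⁻¹) ^ (1 + α)
            ∂(RangeTree.treeLaw N) := by
          refine lintegral_mono fun η => ?_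
          dsimp only
          rw [← ENNReal.mul_rpow_of_nonneg _ _ (by linarith : 0 ≤ 1 + α)]
          refine ENNReal.rpow_le_rpow ?_ (by linarith)
          refine le_trans (le_of_eq ?_) (RangeTree.absDiff_mul_le _ _ _)
          rw [div_eq_mul_inv, mul_right_comm, ENNReal.mul_inv_cancel hn0 (by simp), one_mul]
      _ = (∫⁻ η, RangeTree.absDiff
            (RangeTree.L1 (RangeTree.edgeLocalTime n (RangeTree.typesOf η)))
            (n * RangeTree.Winf (RangeTree.envOf η)) ^ (1 + α) ∂(RangeTree.treeLaw N)) *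
            ((n : ℝ≥0∞)⁻¹) ^ (1 + α) := lintegral_mul_const' _ _ hninv
      _ ≤ K * ((n : ℝ≥0∞) ^ (1 + α / 2) + D * n) * ((n : ℝ≥0∞)⁻¹) ^ (1 + α) := by
          gcongr
          exact hbound n
      _ = _ := by rw [ENNReal.rpow_one]; ring
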